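/- Let $\rho$ be a state (density matrix) of a bipartite quantum system $AB$ with finite-dimensional Hilbert spaces, and let $\sigma_+=|\Phi^+\rangle\langle\Phi^+|$ with $|\Phi^+\rangle=\frac1{\sqrt2}(|00\rangle+|11\rangle)$. An LOCC channel is a channel implemented by a protocol with finitely many rounds, in each of which one of the two parties applies a quantum instrument with finitely many outcomes to her or his subsystem and communicates the outcome to the other party, all later steps being allowed to depend on the earlier outcomes; shared randomness with finitely many values may also be used. The state $\rho$ is called *single-distillable* if $$\inf\{\,\|\sigma_+-\Lambda(\rho^{\otimes N})\|_1 \;:\; N\ge 1,\ \Lambda\text{ an LOCC channel to a pair of qubits}\,\}=0,$$ *distillable with rate $R$* if $$\inf\{\,\|\sigma_+^{\otimes M}-\Lambda(\rho^{\otimes N})\|_1 \;:\; N\ge1,\ M\ge RN \text{ integers},\ \Lambda\text{ an LOCC channel to } M\text{ pairs of qubits}\,\}=0,$$ and *rate-distillable* if it is distillable with some rate $R>0$. Here $\|X\|_1=\operatorname{tr}|X|$. A two-qubit state is *Bell-diagonal* if it is a convex combination of the projectors onto the four Bell states $\frac1{\sqrt2}(|00\rangle\pm|11\rangle)$, $\frac1{\sqrt2}(|01\rangle\pm|10\rangle)$,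 and $S(\tau)=-\operatorname{tr}(\tau\log_2\tau)$ is the von Neumann entropy. **Theorem.** Suppose that $\rho$ is single-distillable. Then: 1. For every $h>0$ there are an integer $N\ge1$ and an LOCC channel $\Lambda$ such that $\Lambda(\rho^{\otimes N})$ is a Bell-diagonal two-qubit state with $S(\Lambda(\rho^{\otimes N}))<h$. 2. Whenever $N\ge1$ and $\Lambda$ is an LOCC channel such that $\rho'=\Lambda(\rho^{\otimes N})$ is a Bell-diagonal two-qubit state with $h=S(\rho')<1$, the state $\rho$ is distillable with rate $\dfrac{1-h}{2N}$. 3. In particular, $\rho$ is rate-distillable. -/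

import Mathlib

open scoped Kronecker MatrixOrder ComplexOrder

noncomputable section

namespace Distill

/-- A (mixed) quantum state: a positive semidefinite matrix of unit trace. -/
def IsState {m : Type} [Fintype m] (ρ : Matrix m m ℂ) : Prop :=
  ρ.PosSemidef ∧ ρ.trace = 1

/-- The trace norm `‖X‖₁ = tr |X|`, where `|X| = √(X† X)`. -/
def traceNorm {m : Type} [Fintype m] [DecidableEq m] (X : Matrix m m ℂ) : ℝ :=
  (Matrix.trace (CFC.abs X)).re

/-- The von Neumann entropy `S(ρ) = - tr (ρ log₂ ρ)` (with `0 log₂ 0 = 0`). -/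
def entropy {m : Type} [Fintype m] [DecidableEq m] (ρ : Matrix m m ℂ) : ℝ :=
  -(Matrix.trace (ρ * cfc (Real.logb 2) ρ)).re

/-- The `N`-fold tensor power of a bipartite matrix, with the `N` subsystems of Alice and the
`N` subsystems of Bob collected on either side of the bipartition. -/
def tensorPow {A B : Type} (ρ : Matrix (A × B) (A × B) ℂ) (N : ℕ) :
    Matrix ((Fin N → A) × (Fin N → B)) ((Fin N → A) × (Fin N → B)) ℂ :=
  Matrix.of fun x y => ∏ i, ρ (x.1 i, x.2 i) (y.1 i, y.2 i)

/-- The Bell vectors, labelled by a phase bit `z` and a flip bit `x`: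
`(|0,x⟩ + (-1)^z |1,1+x⟩)/√2`, that is, `Φ⁺ = (0,0)`, `Φ⁻ = (1,0)`, `Ψ⁺ = (0,1)`, `Ψ⁻ = (1,1)`. -/
def bellVec (z x : Fin 2) : Fin 2 × Fin 2 → ℂ :=
  fun s => if s.2 = s.1 + x then (-1) ^ (z.val * s.1.val) / (Real.sqrt 2 : ℂ) else 0

/-- The projector onto a Bell vector. -/
def bellProj (z x : Fin 2) : Matrix (Fin 2 × Fin 2) (Fin 2 × Fin 2) ℂ :=
  Matrix.vecMulVec (bellVec z x) (star (bellVec z x))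

/-- The maximally entangled two-qubit state `σ₊ = |Φ⁺⟩⟨Φ⁺|`. -/
def sigmaPlus : Matrix (Fin 2 × Fin 2) (Fin 2 × Fin 2) ℂ := bellProj 0 0

/-- Bell-diagonal states: probabilistic mixtures of the four Bell states. -/
def IsBellDiagonal (τ : Matrix (Fin 2 × Fin 2) (Fin 2 × Fin 2) ℂ) : Prop :=
  ∃ p : Fin 2 → Fin 2 → ℝ, (∀ z x, 0 ≤ p z x) ∧ ∑ z, ∑ x, p z x = 1 ∧
    τ = ∑ z, ∑ x, (p z x : ℂ) • bellProj z x

/-- The completely positive map `X ↦ ∑ k, K k * X * (K k)†` with Kraus operators `K k`. -/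
def krausMap {m n κ : Type} [Fintype m] [Fintype κ] (K : κ → Matrix n m ℂ) :
    Matrix m m ℂ →ₗ[ℂ] Matrix n n ℂ where
  toFun X := ∑ k, K k * X * (K k).conjTranspose
  map_add' X Y := by
    simp only [Matrix.mul_add, Matrix.add_mul, Finset.sum_add_distrib]
  map_smul' c X := by
    simp only [Matrix.mul_smul, Matrix.smul_mul, Finset.smul_sum, RingHom.id_apply]

/-- A quantum instrument with finitely many outcomes `i : ι`. The (unnormalized) transformation
conditioned on outcome `i` is the completely positive map with Kraus operators `K i k`, and the
sum over all outcomes preserves the trace. -/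
def IsInstrument {m n ι κ : Type} [Fintype n] [DecidableEq m] [Fintype ι]
    [Fintype κ] (K : ι → κ → Matrix n m ℂ) : Prop :=
  ∑ i, ∑ k, (K i k).conjTranspose * K i k = 1

/-- The channels from the bipartite system `A, B` to the bipartite system `A', B'` that are
implemented by a finite LOCC protocol, defined by recursion on the protocol:
* `done`: nothing remains to be done;
* `alice`: Alice applies an instrument to her subsystem and communicates the outcome `i`; the
  protocol continues depending on `i` (and forgets it at the end);
* `bob`: the same with the roles of the parties exchanged;
* `shared`: the parties use a shared random variable `i` with finitely many values.

The intermediate systems are arbitrary finite-dimensional ones, so that the parties may add and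
discard local subsystems. -/
inductive IsLOCC {A' B' : Type} [Fintype A'] [DecidableEq A'] [Fintype B'] [DecidableEq B'] :
    ∀ {A B : Type} [Fintype A] [DecidableEq A] [Fintype B] [DecidableEq B],
      (Matrix (A × B) (A × B) ℂ →ₗ[ℂ] Matrix (A' × B') (A' × B') ℂ) → Prop
  | done : IsLOCC (A := A') (B := B') LinearMap.id
  | alice {A B C ι κ : Type} [Fintype A] [DecidableEq A] [Fintype B] [DecidableEq B]
      [Fintype C] [DecidableEq C] [Fintype ι] [Fintype κ]
      (K : ι → κ → Matrix C A ℂ) (hK : IsInstrument K)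
      (Γ : ι → (Matrix (C × B) (C × B) ℂ →ₗ[ℂ] Matrix (A' × B') (A' × B') ℂ))
      (hΓ : ∀ i, IsLOCC (Γ i)) :
      IsLOCC (A := A) (B := B)
        (∑ i, (Γ i).comp (krausMap fun k => K i k ⊗ₖ (1 : Matrix B B ℂ)))
  | bob {A B C ι κ : Type} [Fintype A] [DecidableEq A] [Fintype B] [DecidableEq B]
      [Fintype C] [DecidableEq C] [Fintype ι] [Fintype κ]
      (K : ι → κ → Matrix C B ℂ) (hK : IsInstrument K)
      (Γ : ι → (Matrix (A × C) (A × C) ℂ →ₗ[ℂ] Matrix (A' × B') (A' × B') ℂ))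
      (hΓ : ∀ i, IsLOCC (Γ i)) :
      IsLOCC (A := A) (B := B)
        (∑ i, (Γ i).comp (krausMap fun k => (1 : Matrix A A ℂ) ⊗ₖ K i k))
  | shared {A B ι : Type} [Fintype A] [DecidableEq A] [Fintype B] [DecidableEq B] [Fintype ι]
      (p : ι → ℝ) (hp : ∀ i, 0 ≤ p i) (hp1 : ∑ i, p i = 1)
      (Γ : ι → (Matrix (A × B) (A × B) ℂ →ₗ[ℂ] Matrix (A' × B') (A' × B') ℂ))
      (hΓ : ∀ i, IsLOCC (Γ i)) :
      IsLOCC (A := A) (B := B) (∑ i, (p i : ℂ) • Γ i)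

section
variable {A B : Type} [Fintype A] [DecidableEq A] [Fintype B] [DecidableEq B]

/-- `ρ` is single-distillable: the infimum of `‖σ₊ - Λ(ρ^{⊗N})‖₁` over all `N ≥ 1` and all LOCC
channels `Λ` to a pair of qubits is `0`. -/
def SingleDistillable (ρ : Matrix (A × B) (A × B) ℂ) : Prop :=
  IsGLB {r : ℝ | ∃ (N : ℕ)
    (Λ : Matrix ((Fin N → A) × (Fin N → B)) ((Fin N → A) × (Fin N → B)) ℂ →ₗ[ℂ]
      Matrix (Fin 2 × Fin 2) (Fin 2 × Fin 2) ℂ),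
    1 ≤ N ∧ IsLOCC Λ ∧ r = traceNorm (sigmaPlus - Λ (tensorPow ρ N))} 0

/-- `ρ` is distillable with rate `R`: the infimum of `‖σ₊^{⊗M} - Λ(ρ^{⊗N})‖₁` over all `N ≥ 1`,
all `M` with `M ≥ R N`, and all LOCC channels `Λ` to `M` pairs of qubits is `0`. -/
def DistillableAtRate (ρ : Matrix (A × B) (A × B) ℂ) (R : ℝ) : Prop :=
  IsGLB {r : ℝ | ∃ (N M : ℕ)
    (Λ : Matrix ((Fin N → A) × (Fin N → B)) ((Fin N → A) × (Fin N → B)) ℂ →ₗ[ℂ]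
      Matrix ((Fin M → Fin 2) × (Fin M → Fin 2)) ((Fin M → Fin 2) × (Fin M → Fin 2)) ℂ),
    1 ≤ N ∧ R * N ≤ M ∧ IsLOCC Λ ∧
      r = traceNorm (tensorPow sigmaPlus M - Λ (tensorPow ρ N))} 0

/-- `ρ` is rate-distillable: it is distillable with some positive rate. -/
def RateDistillable (ρ : Matrix (A × B) (A × B) ℂ) : Prop :=
  ∃ R : ℝ, 0 < R ∧ DistillableAtRate ρ R

end

end Distill

end

/-!
The state of a pair of qubits obtained from `N` copies of `ρ` is made Bell-diagonal by a bilateral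
Pauli twirl (`twirl_apply`), which keeps its overlap with `Φ⁺`. If this overlap is close to `1`, as
single-distillability permits, then the distribution of the four Bell states is close to a point
mass, and its entropy is small (`SingleDistillable.exists_bellDiagonal`).

A Bell-diagonal state of entropy `h < 1` is distilled by the hashing method, in the form of a single
round of one-way communication. The state of `n` pairs is a mixture of strings of Bell states, that
is, a maximally entangled state on which Bob has suffered a Pauli error `e` with probability
`∏ j, p (e j)`. Alice projects her half onto a code of `k` qubits chosen among the images of one code
under phase flips, and tells Bob the outcome. If `S` is a set of errors that map the code to mutually
orthogonal subspaces, then Bob can identify and undo the errors in `S`, and both parties are left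
with `k` ebits (`exists_isLOCC_traceNorm_le`).

The code is chosen at random: its words are superpositions over the cosets of the graph of a random
binary matrix, with the phases of a random quadratic form. Two given errors are not separated by the
code with probability at most `2 / 2 ^ (n - k)` (`card_not_detects_le`), so that some code separates
nearly all errors of a set with far fewer than `2 ^ (n - k)` elements (`exists_sum_bad_le`). The
typical set has about `2 ^ (n h)` elements, and the errors outside have small probability by a
Chernoff bound (`sum_compl_typicalSet_le`). For `k = ⌈n (1 - h) / 2⌉` there is room between `n h` and
`n - k ≈ n (1 + h) / 2`, so that the failure probability tends to `0`
(`exists_isLOCC_bellDiagonal_rate`).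

LOCC protocols can be composed (`IsLOCC.comp`) and run next to idle subsystems (`IsLOCC.withIdle`),
hence in parallel on many blocks (`Converts.tpow`). This transfers the rate from the Bell-diagonal
state to `ρ` (`distillableAtRate_of_bellDiagonal`).
-/

noncomputable section

set_option linter.unusedSectionVars false

namespace Distill

open Matrix

/-! ### LOCC channels: positivity, trace, composition, idle subsystems -/

section Kraus

variable {m n κ : Type} [Fintype m] [Fintype n] [DecidableEq m] [Fintype κ]

@[simp]
theorem krausMap_apply (K : κ → Matrix n m ℂ) (X : Matrix m m ℂ) :
    krausMap K X = ∑ k, K k * X * (K k).conjTranspose := rfl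

theorem krausMap_posSemidef (K : κ → Matrix n m ℂ) {X : Matrix m m ℂ} (hX : X.PosSemidef) :
    (krausMap K X).PosSemidef := by
  rw [krausMap_apply]
  exact Matrix.posSemidef_sum _ fun k _ => hX.mul_mul_conjTranspose_same (K k)

theorem trace_sum_krausMap {ι : Type} [Fintype ι] (K : ι → κ → Matrix n m ℂ) (hK : IsInstrument K)
    (X : Matrix m m ℂ) : ∑ i, (krausMap (K i) X).trace = X.trace := by
  have h : ∀ i k, (K i k * X * (K i k)ᴴ).trace = ((K i k)ᴴ * K i k * X).trace := fun i k => by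
    rw [Matrix.trace_mul_cycle]
  simp only [krausMap_apply, Matrix.trace_sum, h]
  simp only [← Matrix.trace_sum, ← Matrix.sum_mul]
  rw [hK, Matrix.one_mul]

end Kraus

section

variable {A B C : Type} [Fintype A] [DecidableEq A] [Fintype B] [DecidableEq B] [Fintype C]
  [DecidableEq C]

theorem sum_kronecker {m n p q ι : Type} (s : Finset ι) (F : ι → Matrix m n ℂ)
    (G : Matrix p q ℂ) : (∑ i ∈ s, F i) ⊗ₖ G = ∑ i ∈ s, F i ⊗ₖ G := by
  ext x y
  simp [Matrix.sum_apply, Finset.sum_mul]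

theorem kronecker_sum {m n p q ι : Type} (s : Finset ι) (F : Matrix m n ℂ)
    (G : ι → Matrix p q ℂ) : F ⊗ₖ (∑ i ∈ s, G i) = ∑ i ∈ s, F ⊗ₖ G i := by
  ext x y
  simp [Matrix.sum_apply, Finset.mul_sum]

theorem IsInstrument.kronecker_one {ι κ : Type} [Fintype ι] [Fintype κ] {K : ι → κ → Matrix C A ℂ}
    (hK : IsInstrument K) : IsInstrument fun i k => K i k ⊗ₖ (1 : Matrix B B ℂ) := by
  have h : ∀ i k, (K i k ⊗ₖ (1 : Matrix B B ℂ))ᴴ * (K i k ⊗ₖ (1 : Matrix B B ℂ)) =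
      ((K i k)ᴴ * K i k) ⊗ₖ (1 : Matrix B B ℂ) := fun i k => by
    rw [conjTranspose_kronecker, ← mul_kronecker_mul, conjTranspose_one, Matrix.one_mul]
  unfold IsInstrument at hK ⊢
  simp only [h, ← sum_kronecker, hK, one_kronecker_one]

theorem IsInstrument.one_kronecker {ι κ : Type} [Fintype ι] [Fintype κ] {K : ι → κ → Matrix C B ℂ}
    (hK : IsInstrument K) : IsInstrument fun i k => (1 : Matrix A A ℂ) ⊗ₖ K i k := by
  have h : ∀ i k, ((1 : Matrix A A ℂ) ⊗ₖ K i k)ᴴ * ((1 : Matrix A A ℂ) ⊗ₖ K i k) =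
      (1 : Matrix A A ℂ) ⊗ₖ ((K i k)ᴴ * K i k) := fun i k => by
    rw [conjTranspose_kronecker, ← mul_kronecker_mul, conjTranspose_one, Matrix.one_mul]
  unfold IsInstrument at hK ⊢
  simp only [h, ← kronecker_sum, hK, one_kronecker_one]

end

section LOCC

variable {A' B' : Type} [Fintype A'] [DecidableEq A'] [Fintype B'] [DecidableEq B']
  {A B : Type} [Fintype A] [DecidableEq A] [Fintype B] [DecidableEq B]

theorem IsLOCC.posSemidef
    {Λ : Matrix (A × B) (A × B) ℂ →ₗ[ℂ] Matrix (A' × B') (A' × B') ℂ} (hΛ : IsLOCC Λ)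
    {X : Matrix (A × B) (A × B) ℂ} (hX : X.PosSemidef) : (Λ X).PosSemidef := by
  induction hΛ with
  | done => exact hX
  | alice K hK Γ hΓ ih =>
    rw [LinearMap.sum_apply]
    exact Matrix.posSemidef_sum _ fun i _ => ih i (krausMap_posSemidef _ hX)
  | bob K hK Γ hΓ ih =>
    rw [LinearMap.sum_apply]
    exact Matrix.posSemidef_sum _ fun i _ => ih i (krausMap_posSemidef _ hX)
  | shared p hp hp1 Γ hΓ ih =>
    rw [LinearMap.sum_apply]
    exact Matrix.posSemidef_sum _ fun i _ => (ih i hX).smul (by exact_mod_cast hp i)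

theorem IsLOCC.trace_apply
    {Λ : Matrix (A × B) (A × B) ℂ →ₗ[ℂ] Matrix (A' × B') (A' × B') ℂ} (hΛ : IsLOCC Λ)
    (X : Matrix (A × B) (A × B) ℂ) : (Λ X).trace = X.trace := by
  induction hΛ with
  | done => rfl
  | alice K hK Γ hΓ ih =>
    simp only [LinearMap.sum_apply, LinearMap.comp_apply, Matrix.trace_sum, ih]
    exact trace_sum_krausMap _ hK.kronecker_one X
  | bob K hK Γ hΓ ih =>
    simp only [LinearMap.sum_apply, LinearMap.comp_apply, Matrix.trace_sum, ih]
    exact trace_sum_krausMap _ hK.one_kronecker X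
  | shared p hp hp1 Γ hΓ ih =>
    simp only [LinearMap.sum_apply, LinearMap.smul_apply, Matrix.trace_sum, Matrix.trace_smul, ih,
      ← Finset.sum_smul]
    rw [← Complex.ofReal_sum, hp1]
    simp

theorem IsLOCC.isState
    {Λ : Matrix (A × B) (A × B) ℂ →ₗ[ℂ] Matrix (A' × B') (A' × B') ℂ} (hΛ : IsLOCC Λ)
    {ρ : Matrix (A × B) (A × B) ℂ} (hρ : IsState ρ) : IsState (Λ ρ) :=
  ⟨hΛ.posSemidef hρ.1, (hΛ.trace_apply ρ).trans hρ.2⟩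

theorem comp_sum {E F G ι : Type} [AddCommGroup E] [AddCommGroup F] [AddCommGroup G] [Module ℂ E]
    [Module ℂ F] [Module ℂ G] [Fintype ι] (g : F →ₗ[ℂ] G) (f : ι → E →ₗ[ℂ] F) :
    g.comp (∑ i, f i) = ∑ i, g.comp (f i) :=
  LinearMap.ext fun x => by simp

theorem IsLOCC.comp {A'' B'' : Type} [Fintype A''] [DecidableEq A''] [Fintype B'']
    [DecidableEq B''] {Λ : Matrix (A × B) (A × B) ℂ →ₗ[ℂ] Matrix (A' × B') (A' × B') ℂ}
    {Θ : Matrix (A' × B') (A' × B') ℂ →ₗ[ℂ] Matrix (A'' × B'') (A'' × B'') ℂ}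
    (hΘ : IsLOCC Θ) (hΛ : IsLOCC Λ) : IsLOCC (Θ.comp Λ) := by
  induction hΛ with
  | done => exact hΘ
  | alice K hK Γ hΓ ih =>
    rw [comp_sum]
    exact IsLOCC.alice K hK (fun i => Θ.comp (Γ i)) ih
  | bob K hK Γ hΓ ih =>
    rw [comp_sum]
    exact IsLOCC.bob K hK (fun i => Θ.comp (Γ i)) ih
  | shared p hp hp1 Γ hΓ ih =>
    rw [comp_sum]
    simp only [LinearMap.comp_smul]
    exact IsLOCC.shared p hp hp1 (fun i => Θ.comp (Γ i)) ih

/-- The one-way protocol in which Alice applies the instrument with Kraus operators `K i` and Bob,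
told the outcome `i`, applies the channel with Kraus operators `L i k`. -/
theorem IsLOCC.oneWay {ι κ : Type} [Fintype ι] [Fintype κ] (K : ι → Matrix A' A ℂ)
    (hK : ∑ i, (K i)ᴴ * K i = 1) (L : ι → κ → Matrix B' B ℂ)
    (hL : ∀ i, ∑ k, (L i k)ᴴ * L i k = 1) :
    IsLOCC (krausMap fun x : ι × κ => K x.1 ⊗ₖ L x.1 x.2) := by
  have h := IsLOCC.alice (A' := A') (B' := B') (B := B) (fun i (_ : Unit) => K i)
    (by simpa [IsInstrument] using hK) _ fun i =>
      IsLOCC.bob (A' := A') (B' := B') (fun (_ : Unit) k => L i k)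
        (by simpa [IsInstrument] using hL i) (fun _ => LinearMap.id) fun _ => IsLOCC.done
  convert h using 1
  refine LinearMap.ext fun X => ?_
  have hkl : ∀ i k, K i ⊗ₖ L i k = ((1 : Matrix A' A' ℂ) ⊗ₖ L i k) * (K i ⊗ₖ (1 : Matrix B B ℂ)) :=
    fun i k => by rw [← mul_kronecker_mul, Matrix.one_mul, Matrix.mul_one]
  simp [hkl, Fintype.sum_prod_type, Matrix.mul_assoc]

/-- The action of a linear map on the factor `A × B` of the system `(A × E) × (B × F)`, in which
`E` and `F` are idle subsystems of the two parties. -/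
def withIdle (E F : Type) (Λ : Matrix (A × B) (A × B) ℂ →ₗ[ℂ] Matrix (A' × B') (A' × B') ℂ) :
    Matrix ((A × E) × (B × F)) ((A × E) × (B × F)) ℂ →ₗ[ℂ]
      Matrix ((A' × E) × (B' × F)) ((A' × E) × (B' × F)) ℂ where
  toFun X := of fun s t =>
    Λ (of fun a b => X ((a.1, s.1.2), (a.2, s.2.2)) ((b.1, t.1.2), (b.2, t.2.2)))
      (s.1.1, s.2.1) (t.1.1, t.2.1)
  map_add' X Y := by
    ext s t
    simp only [of_apply, Matrix.add_apply]
    rw [← Matrix.add_apply, ← map_add]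
    rfl
  map_smul' c X := by
    ext s t
    simp only [of_apply, Matrix.smul_apply, RingHom.id_apply]
    rw [← Matrix.smul_apply, ← map_smul]
    rfl

theorem withIdle_apply {E F : Type}
    (Λ : Matrix (A × B) (A × B) ℂ →ₗ[ℂ] Matrix (A' × B') (A' × B') ℂ)
    (X : Matrix ((A × E) × (B × F)) ((A × E) × (B × F)) ℂ) (s t : (A' × E) × (B' × F)) :
    withIdle E F Λ X s t =
      Λ (of fun a b => X ((a.1, s.1.2), (a.2, s.2.2)) ((b.1, t.1.2), (b.2, t.2.2)))
        (s.1.1, s.2.1) (t.1.1, t.2.1) := rfl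

theorem kronecker_one_conj_apply {C : Type} (K : Matrix C A ℂ) (X : Matrix (A × B) (A × B) ℂ)
    (s t : C × B) :
    ((K ⊗ₖ (1 : Matrix B B ℂ)) * X * (K ⊗ₖ (1 : Matrix B B ℂ))ᴴ) s t =
      ∑ a', ∑ a, K s.1 a * X (a, s.2) (a', t.2) * star (K t.1 a') := by
  simp [Matrix.mul_apply, Fintype.sum_prod_type, Matrix.one_apply, Finset.sum_mul, apply_ite]

theorem one_kronecker_conj_apply {C : Type} (K : Matrix C B ℂ) (X : Matrix (A × B) (A × B) ℂ)
    (s t : A × C) :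
    (((1 : Matrix A A ℂ) ⊗ₖ K) * X * ((1 : Matrix A A ℂ) ⊗ₖ K)ᴴ) s t =
      ∑ b', ∑ b, K s.2 b * X (s.1, b) (t.1, b') * star (K t.2 b') := by
  rw [Matrix.mul_apply, Fintype.sum_prod_type, Finset.sum_comm]
  simp [Matrix.mul_apply, Fintype.sum_prod_type, Matrix.one_apply, Finset.sum_mul, apply_ite]

theorem withIdle_krausMap_left {E F C κ : Type} [Fintype C] [DecidableEq C] [Fintype E] [DecidableEq E] [Fintype F]
    [DecidableEq F] [Fintype κ] (K : κ → Matrix C A ℂ) :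
    withIdle E F (krausMap fun k => K k ⊗ₖ (1 : Matrix B B ℂ)) =
      krausMap fun k => (K k ⊗ₖ (1 : Matrix E E ℂ)) ⊗ₖ (1 : Matrix (B × F) (B × F) ℂ) := by
  refine LinearMap.ext fun X => ?_
  ext s t
  rw [withIdle_apply]
  simp only [krausMap_apply, Matrix.sum_apply, kronecker_one_conj_apply]
  refine Finset.sum_congr rfl fun k _ => ?_
  simp [Fintype.sum_prod_type, Matrix.one_apply, apply_ite]

theorem withIdle_krausMap_right {E F C κ : Type} [Fintype C] [DecidableEq C] [Fintype E] [DecidableEq E] [Fintype F]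
    [DecidableEq F] [Fintype κ] (K : κ → Matrix C B ℂ) :
    withIdle E F (krausMap fun k => (1 : Matrix A A ℂ) ⊗ₖ K k) =
      krausMap fun k => (1 : Matrix (A × E) (A × E) ℂ) ⊗ₖ (K k ⊗ₖ (1 : Matrix F F ℂ)) := by
  refine LinearMap.ext fun X => ?_
  ext s t
  rw [withIdle_apply]
  simp only [krausMap_apply, Matrix.sum_apply, one_kronecker_conj_apply]
  refine Finset.sum_congr rfl fun k _ => ?_
  simp [Fintype.sum_prod_type, Matrix.one_apply, apply_ite]

theorem withIdle_sum {E F ι : Type} [Fintype ι]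
    (Γ : ι → (Matrix (A × B) (A × B) ℂ →ₗ[ℂ] Matrix (A' × B') (A' × B') ℂ)) :
    withIdle E F (∑ i, Γ i) = ∑ i, withIdle E F (Γ i) := by
  refine LinearMap.ext fun X => ?_
  ext s t
  simp [withIdle_apply, Matrix.sum_apply]

theorem IsLOCC.withIdle (E F : Type) [Fintype E] [DecidableEq E] [Fintype F] [DecidableEq F]
    {Λ : Matrix (A × B) (A × B) ℂ →ₗ[ℂ] Matrix (A' × B') (A' × B') ℂ} (hΛ : IsLOCC Λ) :
    IsLOCC (withIdle E F Λ) := by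
  induction hΛ with
  | done => exact IsLOCC.done
  | alice K hK Γ hΓ ih =>
    convert IsLOCC.alice (fun i k => K i k ⊗ₖ (1 : Matrix E E ℂ)) hK.kronecker_one
      (fun i => Distill.withIdle E F (Γ i)) ih using 1
    rw [withIdle_sum]
    refine Finset.sum_congr rfl fun i _ => ?_
    rw [← withIdle_krausMap_left]
    rfl
  | bob K hK Γ hΓ ih =>
    convert IsLOCC.bob (fun i k => K i k ⊗ₖ (1 : Matrix F F ℂ)) hK.kronecker_one
      (fun i => Distill.withIdle E F (Γ i)) ih using 1
    rw [withIdle_sum]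
    refine Finset.sum_congr rfl fun i _ => ?_
    rw [← withIdle_krausMap_right]
    rfl
  | shared p hp hp1 Γ hΓ ih =>
    convert IsLOCC.shared p hp hp1 (fun i => Distill.withIdle E F (Γ i)) ih using 1
    rw [withIdle_sum]
    rfl

end LOCC

/-! ### Convertibility of bipartite matrices under LOCC -/

section Converts

/-- `ρ` is turned into `τ` by some LOCC channel. -/
def Converts {A B A' B' : Type} [Fintype A] [DecidableEq A] [Fintype B] [DecidableEq B]
    [Fintype A'] [DecidableEq A'] [Fintype B'] [DecidableEq B']
    (ρ : Matrix (A × B) (A × B) ℂ) (τ : Matrix (A' × B') (A' × B') ℂ) : Prop :=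
  ∃ Λ : Matrix (A × B) (A × B) ℂ →ₗ[ℂ] Matrix (A' × B') (A' × B') ℂ, IsLOCC Λ ∧ Λ ρ = τ

variable {A B A' B' A'' B'' : Type} [Fintype A] [DecidableEq A] [Fintype B] [DecidableEq B]
    [Fintype A'] [DecidableEq A'] [Fintype B'] [DecidableEq B']
    [Fintype A''] [DecidableEq A''] [Fintype B''] [DecidableEq B'']

theorem Converts.trans {ρ : Matrix (A × B) (A × B) ℂ} {τ : Matrix (A' × B') (A' × B') ℂ}
    {ω : Matrix (A'' × B'') (A'' × B'') ℂ} (h : Converts ρ τ) (h' : Converts τ ω) :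
    Converts ρ ω := by
  obtain ⟨Λ, hΛ, rfl⟩ := h
  obtain ⟨Θ, hΘ, rfl⟩ := h'
  exact ⟨Θ.comp Λ, hΘ.comp hΛ, rfl⟩

/-- Each party may relabel the basis of her or his subsystem. -/
theorem converts_submatrix (e : A' ≃ A) (f : B' ≃ B) (ρ : Matrix (A × B) (A × B) ℂ) :
    Converts ρ (ρ.submatrix (Prod.map e f) (Prod.map e f)) := by
  refine ⟨_, IsLOCC.oneWay (fun _ : Unit => (1 : Matrix A A ℂ).submatrix e id) ?_
    (fun _ (_ : Unit) => (1 : Matrix B B ℂ).submatrix f id) ?_, ?_⟩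
  · simp [Matrix.conjTranspose_submatrix]
  · intro _
    simp [Matrix.conjTranspose_submatrix]
  · ext s t
    simp [Matrix.mul_apply, Fintype.sum_prod_type, Matrix.one_apply, apply_ite, Prod.map]

/-- The tensor power of a bipartite matrix over an arbitrary index type `J`, all of Alice's
subsystems being collected on the left and all of Bob's on the right. -/
def tpow (J : Type) [Fintype J] (ρ : Matrix (A × B) (A × B) ℂ) :
    Matrix ((J → A) × (J → B)) ((J → A) × (J → B)) ℂ :=
  of fun x y => ∏ j, ρ (x.1 j, x.2 j) (y.1 j, y.2 j)

theorem tpow_apply (J : Type) [Fintype J] (ρ : Matrix (A × B) (A × B) ℂ)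
    (x y : (J → A) × (J → B)) :
    tpow J ρ x y = ∏ j, ρ (x.1 j, x.2 j) (y.1 j, y.2 j) := rfl

theorem converts_tpow_congr {J J' : Type} [Fintype J] [DecidableEq J] [Fintype J'] [DecidableEq J']
    (e : J ≃ J') (ρ : Matrix (A × B) (A × B) ℂ) : Converts (tpow J ρ) (tpow J' ρ) := by
  convert converts_submatrix (e.arrowCongr (Equiv.refl A)).symm (e.arrowCongr (Equiv.refl B)).symm
    (tpow J ρ) using 1
  ext x y
  simp only [tpow_apply, submatrix_apply, Prod.map]
  exact (Fintype.prod_equiv e _ _ fun j => rfl).symm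

theorem converts_tpow_prod {J I : Type} [Fintype J] [DecidableEq J] [Fintype I] [DecidableEq I]
    (ρ : Matrix (A × B) (A × B) ℂ) : Converts (tpow (J × I) ρ) (tpow J (tpow I ρ)) := by
  convert converts_submatrix (Equiv.curry J I A).symm (Equiv.curry J I B).symm
    (tpow (J × I) ρ) using 1
  ext x y
  simp only [tpow_apply, submatrix_apply, Prod.map, Fintype.prod_prod_type]
  rfl

theorem Converts.withIdle {ρ : Matrix (A × B) (A × B) ℂ} {τ : Matrix (A' × B') (A' × B') ℂ}
    (h : Converts ρ τ) (ω : Matrix (A'' × B'') (A'' × B'') ℂ) :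
    Converts (A := A × A'') (B := B × B'') (A' := A' × A'') (B' := B' × B'')
      (of fun s t => ρ (s.1.1, s.2.1) (t.1.1, t.2.1) * ω (s.1.2, s.2.2) (t.1.2, t.2.2))
      (of fun s t => τ (s.1.1, s.2.1) (t.1.1, t.2.1) * ω (s.1.2, s.2.2) (t.1.2, t.2.2)) := by
  obtain ⟨Λ, hΛ, rfl⟩ := h
  refine ⟨_, hΛ.withIdle A'' B'', ?_⟩
  ext s t
  rw [withIdle_apply, of_apply, mul_comm, ← smul_eq_mul, ← Matrix.smul_apply, ← map_smul]
  refine congrFun (congrFun (congrArg Λ ?_) _) _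
  ext a b
  simp [mul_comm]

theorem Converts.swapped {ρ : Matrix (A × B) (A × B) ℂ} {τ : Matrix (A' × B') (A' × B') ℂ}
    (h : Converts ρ τ) (ω : Matrix (A'' × B'') (A'' × B'') ℂ) :
    Converts (A := A'' × A) (B := B'' × B) (A' := A'' × A') (B' := B'' × B')
      (of fun s t => ω (s.1.1, s.2.1) (t.1.1, t.2.1) * ρ (s.1.2, s.2.2) (t.1.2, t.2.2))
      (of fun s t => ω (s.1.1, s.2.1) (t.1.1, t.2.1) * τ (s.1.2, s.2.2) (t.1.2, t.2.2)) := by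
  have h1 := converts_submatrix (Equiv.prodComm A A'') (Equiv.prodComm B B'')
    (of fun s t => ω (s.1.1, s.2.1) (t.1.1, t.2.1) * ρ (s.1.2, s.2.2) (t.1.2, t.2.2))
  have h2 := converts_submatrix (Equiv.prodComm A'' A') (Equiv.prodComm B'' B')
    (of fun s t => τ (s.1.1, s.2.1) (t.1.1, t.2.1) * ω (s.1.2, s.2.2) (t.1.2, t.2.2))
  convert (h1.trans (?_ : Converts _ _)).trans h2 using 1
  · ext s t; simp [mul_comm]
  · convert h.withIdle ω using 1
    ext s t; simp [mul_comm]

/-- An LOCC protocol can be run on all tensor factors in parallel. -/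
theorem Converts.tpow {ρ : Matrix (A × B) (A × B) ℂ} {τ : Matrix (A' × B') (A' × B') ℂ}
    (h : Converts ρ τ) (J : Type) [Fintype J] [DecidableEq J] :
    Converts (tpow J ρ) (tpow J τ) := by
  suffices H : ∀ n : ℕ, Converts (Distill.tpow (Fin n) ρ) (Distill.tpow (Fin n) τ) from
    ((converts_tpow_congr (Fintype.equivFin J) ρ).trans (H _)).trans
      (converts_tpow_congr (Fintype.equivFin J).symm τ)
  intro n
  induction n with
  | zero =>
    convert converts_submatrix (Equiv.ofUnique (Fin 0 → A') (Fin 0 → A))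
      (Equiv.ofUnique (Fin 0 → B') (Fin 0 → B)) (Distill.tpow (Fin 0) ρ) using 1
    ext x y
    simp [tpow_apply]
  | succ n ih =>
    have h1 := converts_submatrix (Fin.consEquiv fun _ : Fin (n + 1) => A)
      (Fin.consEquiv fun _ : Fin (n + 1) => B) (Distill.tpow (Fin (n + 1)) ρ)
    have h2 := converts_submatrix (Fin.consEquiv fun _ : Fin (n + 1) => A').symm
      (Fin.consEquiv fun _ : Fin (n + 1) => B').symm
      (of fun s t => τ (s.1.1, s.2.1) (t.1.1, t.2.1) *
        Distill.tpow (Fin n) τ (s.1.2, s.2.2) (t.1.2, t.2.2))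
    have h3 := (h.withIdle (Distill.tpow (Fin n) ρ)).trans (ih.swapped τ)
    convert (h1.trans (?_ : Converts _ _)).trans h2 using 1
    · ext x y
      simp [tpow_apply, Fin.prod_univ_succ, Fin.consEquiv, Fin.tail]
    · convert h3 using 1
      ext x y
      simp [tpow_apply, Fin.prod_univ_succ, Fin.consEquiv]

end Converts

/-! ### The trace norm -/

section TraceNorm

variable {m : Type} [Fintype m] [DecidableEq m]

theorem re_trace_nonneg {X : Matrix m m ℂ} (hX : X.PosSemidef) : 0 ≤ X.trace.re :=
  (Complex.le_def.1 hX.trace_nonneg).1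

theorem traceNorm_nonneg (X : Matrix m m ℂ) : 0 ≤ traceNorm X :=
  re_trace_nonneg (Matrix.nonneg_iff_posSemidef.1 (CFC.abs_nonneg X))

theorem re_trace_mul_nonneg {X Y : Matrix m m ℂ} (hX : X.PosSemidef) (hY : Y.PosSemidef) :
    0 ≤ (X * Y).trace.re := by
  obtain ⟨C, rfl⟩ := CStarAlgebra.nonneg_iff_eq_star_mul_self.1 hX.nonneg
  rw [Matrix.star_eq_conjTranspose]
  rw [Matrix.mul_assoc, Matrix.trace_mul_comm, Matrix.mul_assoc, ← Matrix.mul_assoc]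
  exact re_trace_nonneg (hY.mul_mul_conjTranspose_same C)

theorem re_trace_mul_mono {X Y Z : Matrix m m ℂ} (hX : X.PosSemidef) (hYZ : Y ≤ Z) :
    (X * Y).trace.re ≤ (X * Z).trace.re := by
  have := re_trace_mul_nonneg hX (Matrix.le_iff.1 hYZ)
  rw [Matrix.mul_sub, Matrix.trace_sub, Complex.sub_re] at this
  linarith

/-- Here `|P - N| = S (P - N)` with `S` the sign of `P - N`, and `-1 ≤ S ≤ 1`. -/
theorem traceNorm_sub_le {P N : Matrix m m ℂ} (hP : P.PosSemidef) (hN : N.PosSemidef) :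
    traceNorm (P - N) ≤ P.trace.re + N.trace.re := by
  set X := P - N with hXdef
  have hX : IsSelfAdjoint X := hP.isHermitian.sub hN.isHermitian
  have hcont : ∀ f : ℝ → ℝ, ContinuousOn f (spectrum ℝ X) := fun f =>
    (Matrix.finite_real_spectrum).continuousOn f
  set S := cfc (fun x : ℝ => (SignType.sign x : ℝ)) X with hS
  have habs : CFC.abs X = S * X := by
    rw [CFC.abs_eq_cfc_norm X hX]
    conv_rhs => rw [hS]; enter [2]; rw [← cfc_id' ℝ X hX]
    rw [← cfc_mul _ _ X (hcont _) (hcont _)]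
    refine cfc_congr fun x _ => ?_
    simp [Real.norm_eq_abs, sign_mul_self]
  have hS1 : S ≤ 1 := by
    refine cfc_le_one _ _ fun x _ => ?_
    rcases lt_trichotomy x 0 with h | h | h <;> simp [h]
  have hS2 : -1 ≤ S := by
    rw [neg_le, hS, ← cfc_neg]
    refine cfc_le_one _ _ fun x _ => ?_
    rcases lt_trichotomy x 0 with h | h | h <;> simp [h]
  have h1 := re_trace_mul_nonneg (Matrix.le_iff.1 hS1) hP
  have h2 := re_trace_mul_nonneg (Matrix.le_iff.1 hS2) hN
  simp only [Matrix.sub_mul, Matrix.neg_mul, Matrix.one_mul, Matrix.trace_sub, Matrix.trace_neg,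
    Complex.sub_re, Complex.neg_re] at h1 h2
  rw [traceNorm, habs, hXdef, Matrix.mul_sub, Matrix.trace_sub, Complex.sub_re]
  linarith

/-- The expectation of an effect `0 ≤ Y ≤ 1` is at most the trace norm, because `X ≤ |X|`. -/
theorem re_trace_mul_le_traceNorm {X Y : Matrix m m ℂ} (hX : X.IsHermitian) (hY : Y.PosSemidef)
    (hY1 : Y ≤ 1) : (Y * X).trace.re ≤ traceNorm X := by
  have h1 : X ≤ CFC.abs X := by
    rw [← sub_nonneg, CFC.abs_sub_self X hX]
    exact nsmul_nonneg (CFC.negPart_nonneg X) 2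
  have h0 : (CFC.abs X).PosSemidef := Matrix.nonneg_iff_posSemidef.1 (CFC.abs_nonneg X)
  have h2 := re_trace_mul_mono h0 hY1
  rw [Matrix.trace_mul_comm, Matrix.mul_one] at h2
  exact (re_trace_mul_mono hY h1).trans h2

end TraceNorm

/-! ### Bell-diagonal states: entropy and twirling -/

section Resolution

variable {m ι : Type} [Fintype m] [DecidableEq m] [Fintype ι] [DecidableEq ι]

/-- Functional calculus of a real combination of the members of a resolution of the identity. -/
theorem cfc_sum_smul {P : ι → Matrix m m ℂ} (hmul : ∀ i j, P i * P j = if i = j then P i else 0)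
    (hsum : ∑ i, P i = 1) (hP : ∀ i, (P i).IsHermitian) (c : ι → ℝ) (f : ℝ → ℝ) :
    cfc f (∑ i, c i • P i) = ∑ i, f (c i) • P i := by
  set X := ∑ i, c i • P i with hX
  have hXs : IsSelfAdjoint X := isSelfAdjoint_sum _ fun i _ => (IsSelfAdjoint.all (c i)).smul (hP i).isSelfAdjoint
  have hpoly : ∀ q : Polynomial ℝ, Polynomial.aeval X q = ∑ i, q.eval (c i) • P i := by
    intro q
    induction q using Polynomial.induction_on' with
    | add p q hp hq => simp [hp, hq, add_smul, Finset.sum_add_distrib]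
    | monomial n a =>
      have hpow : X ^ n = ∑ i, c i ^ n • P i := by
        induction n with
        | zero => simp [hsum]
        | succ n ih =>
          rw [pow_succ, ih, hX, Finset.sum_mul]
          refine Finset.sum_congr rfl fun i _ => ?_
          simp [Finset.mul_sum, hmul, smul_smul, pow_succ, mul_comm]
      simp [Polynomial.aeval_monomial, hpow, Finset.mul_sum, Algebra.algebraMap_eq_smul_one,
        smul_smul, mul_comm]
  -- on the spectrum and on the values `c i`, `f` agrees with a polynomial
  set S : Finset ℝ := (Matrix.finite_real_spectrum (A := X)).toFinset ∪ Finset.univ.image c with hS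
  set q := Lagrange.interpolate S id f with hq
  have hnode : ∀ x ∈ S, q.eval x = f x := fun x hx =>
    Lagrange.eval_interpolate_at_node f (Function.injective_id.injOn) hx
  have h1 : cfc f X = cfc (fun x => q.eval x) X :=
    cfc_congr fun x hx => (hnode x (by simp [hS, hx])).symm
  rw [h1, cfc_polynomial q X hXs, hpoly]
  exact Finset.sum_congr rfl fun i _ => by rw [hnode (c i) (by simp [hS])]

theorem entropy_sum_smul {P : ι → Matrix m m ℂ}
    (hmul : ∀ i j, P i * P j = if i = j then P i else 0)
    (hsum : ∑ i, P i = 1) (hP : ∀ i, (P i).IsHermitian) (htr : ∀ i, (P i).trace = 1) (c : ι → ℝ) :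
    entropy (∑ i, (c i : ℂ) • P i) = (∑ i, Real.negMulLog (c i)) / Real.log 2 := by
  simp only [Complex.coe_smul]
  rw [entropy, cfc_sum_smul hmul hsum hP]
  have : (∑ i, c i • P i) * (∑ i, Real.logb 2 (c i) • P i) =
      ∑ i, (c i * Real.logb 2 (c i)) • P i := by
    rw [Finset.sum_mul]
    refine Finset.sum_congr rfl fun i _ => ?_
    simp [Finset.mul_sum, hmul, smul_smul, mul_comm]
  rw [this]
  have htrace : (∑ i, (c i * Real.logb 2 (c i)) • P i).trace =
      ((∑ i, c i * Real.logb 2 (c i) : ℝ) : ℂ) := by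
    simp only [Matrix.trace_sum, Matrix.trace_smul, htr, Complex.ofReal_sum, Complex.real_smul,
      mul_one]
  rw [htrace, Complex.ofReal_re, Finset.sum_div, ← Finset.sum_neg_distrib]
  exact Finset.sum_congr rfl fun i _ => by rw [Real.negMulLog, Real.logb]; ring

end Resolution

section Bell

theorem inv_sqrt_two_mul_self : (Real.sqrt 2 : ℂ)⁻¹ * (Real.sqrt 2 : ℂ)⁻¹ = 1 / 2 := by
  rw [← mul_inv, ← Complex.ofReal_mul, Real.mul_self_sqrt (by norm_num)]
  simp

theorem bellVec_orthonormal (e f : Fin 2 × Fin 2) :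
    star (bellVec e.1 e.2) ⬝ᵥ bellVec f.1 f.2 = if e = f then 1 else 0 := by
  have h3 := inv_sqrt_two_mul_self
  obtain ⟨a, b⟩ := e
  obtain ⟨c, d⟩ := f
  fin_cases a <;> fin_cases b <;> fin_cases c <;> fin_cases d <;>
    simp [dotProduct, bellVec, Fintype.sum_prod_type, h3, div_eq_mul_inv] <;> norm_num

theorem sum_bellProj : ∑ e : Fin 2 × Fin 2, bellProj e.1 e.2 = 1 := by
  have h3 := inv_sqrt_two_mul_self
  ext ⟨a, b⟩ ⟨c, d⟩
  fin_cases a <;> fin_cases b <;> fin_cases c <;> fin_cases d <;>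
    simp [bellProj, vecMulVec_apply, bellVec, Fintype.sum_prod_type, h3, div_eq_mul_inv,
      Matrix.sum_apply] <;> norm_num

theorem bellProj_mul (e f : Fin 2 × Fin 2) :
    bellProj e.1 e.2 * bellProj f.1 f.2 = if e = f then bellProj e.1 e.2 else 0 := by
  rw [bellProj, bellProj, vecMulVec_mul_vecMulVec, bellVec_orthonormal]
  split_ifs with h
  · simp [h]
  · simp

theorem bellProj_posSemidef (z x : Fin 2) : (bellProj z x).PosSemidef :=
  posSemidef_vecMulVec_self_star _

theorem trace_bellProj (z x : Fin 2) : (bellProj z x).trace = 1 := by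
  rw [bellProj, trace_vecMulVec, dotProduct_comm]
  simpa using bellVec_orthonormal (z, x) (z, x)

theorem bellProj_le_one (z x : Fin 2) : bellProj z x ≤ 1 := by
  rw [Matrix.le_iff, ← sum_bellProj,
    ← Finset.add_sum_erase Finset.univ _ (Finset.mem_univ ((z, x) : Fin 2 × Fin 2)),
    add_sub_cancel_left]
  exact Matrix.posSemidef_sum _ fun e _ => bellProj_posSemidef e.1 e.2

theorem entropy_bellDiagonal (p : Fin 2 × Fin 2 → ℝ) :
    entropy (∑ e : Fin 2 × Fin 2, (p e : ℂ) • bellProj e.1 e.2) =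
      (∑ e, Real.negMulLog (p e)) / Real.log 2 :=
  entropy_sum_smul bellProj_mul sum_bellProj (fun _ => (bellProj_posSemidef _ _).isHermitian)
    (fun _ => trace_bellProj _ _) p

theorem IsBellDiagonal.exists_prod {τ : Matrix (Fin 2 × Fin 2) (Fin 2 × Fin 2) ℂ}
    (h : IsBellDiagonal τ) : ∃ p : Fin 2 × Fin 2 → ℝ, (∀ e, 0 ≤ p e) ∧ ∑ e, p e = 1 ∧
      τ = ∑ e, (p e : ℂ) • bellProj e.1 e.2 := by
  obtain ⟨p, hp, h1, h⟩ := h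
  exact ⟨fun e => p e.1 e.2, fun e => hp _ _, by rw [Fintype.sum_prod_type]; exact h1,
    by rw [Fintype.sum_prod_type]; exact h⟩

/-- The real Pauli matrix `X^x Z^z`. -/
def pauli (z x : Fin 2) : Matrix (Fin 2) (Fin 2) ℂ :=
  of fun s t => if s = t + x then (-1) ^ (z.val * t.val) else 0

/-- The bilateral Pauli twirl replaces `τ` by its diagonal part in the Bell basis. -/
theorem twirl_apply (τ : Matrix (Fin 2 × Fin 2) (Fin 2 × Fin 2) ℂ) :
    ∑ g : Fin 2 × Fin 2, (1 / 4 : ℂ) • ((pauli g.1 g.2 ⊗ₖ pauli g.1 g.2) * τ *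
      (pauli g.1 g.2 ⊗ₖ pauli g.1 g.2)ᴴ) =
    ∑ e : Fin 2 × Fin 2, (bellProj e.1 e.2 * τ).trace • bellProj e.1 e.2 := by
  have h3 := inv_sqrt_two_mul_self
  ext ⟨a, b⟩ ⟨c, d⟩
  simp only [Matrix.sum_apply, Matrix.smul_apply, Fintype.sum_prod_type, Fin.sum_univ_two,
    Matrix.mul_apply, Matrix.trace, Matrix.diag_apply, bellProj, vecMulVec_apply, bellVec,
    kronecker_apply, pauli, of_apply, conjTranspose_apply, Pi.star_apply]
  fin_cases a <;> fin_cases b <;> fin_cases c <;> fin_cases d <;>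
    simp [h3, div_eq_mul_inv] <;> ring

end Bell

theorem pauli_conjTranspose_mul_self (z x : Fin 2) : (pauli z x)ᴴ * pauli z x = 1 := by
  ext a b
  fin_cases z <;> fin_cases x <;> fin_cases a <;> fin_cases b <;>
    simp [pauli, Matrix.mul_apply]

theorem isLOCC_twirl : IsLOCC (krausMap fun g : (Fin 2 × Fin 2) × Unit =>
    ((1 / 2 : ℂ) • pauli g.1.1 g.1.2) ⊗ₖ pauli g.1.1 g.1.2) := by
  refine IsLOCC.oneWay (fun g : Fin 2 × Fin 2 => (1 / 2 : ℂ) • pauli g.1 g.2) ?_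
    (fun g (_ : Unit) => pauli g.1 g.2) ?_
  · simp [conjTranspose_smul, pauli_conjTranspose_mul_self, Finset.sum_const, smul_smul,
      ← Nat.cast_smul_eq_nsmul ℂ]
    norm_num
  · simp [pauli_conjTranspose_mul_self]

/-- Twirling produces a Bell-diagonal state without changing the overlaps with the Bell states. -/
theorem IsState.exists_converts_bellDiagonal {τ : Matrix (Fin 2 × Fin 2) (Fin 2 × Fin 2) ℂ}
    (hτ : IsState τ) : ∃ p : Fin 2 × Fin 2 → ℝ, (∀ e, 0 ≤ p e) ∧ ∑ e, p e = 1 ∧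
      p (0, 0) = (sigmaPlus * τ).trace.re ∧
      Converts τ (∑ e, (p e : ℂ) • bellProj e.1 e.2) := by
  have hre : ∀ e : Fin 2 × Fin 2,
      (((bellProj e.1 e.2 * τ).trace.re : ℝ) : ℂ) = (bellProj e.1 e.2 * τ).trace := by
    intro e
    have h := hτ.1.mul_mul_conjTranspose_same (bellProj e.1 e.2)
    rw [(bellProj_posSemidef e.1 e.2).isHermitian.eq] at h
    have ht := h.trace_nonneg
    rw [Matrix.trace_mul_comm, ← Matrix.mul_assoc, bellProj_mul, if_pos rfl] at ht
    exact (Complex.eq_re_of_ofReal_le (r := 0) (by simpa using ht)).symm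
  refine ⟨fun e => (bellProj e.1 e.2 * τ).trace.re,
    fun e => re_trace_mul_nonneg (bellProj_posSemidef _ _) hτ.1, ?_, rfl, _, isLOCC_twirl, ?_⟩
  · rw [← Complex.re_sum, ← Matrix.trace_sum, ← Finset.sum_mul, sum_bellProj, Matrix.one_mul, hτ.2]
    rfl
  · simp only [hre]
    rw [← twirl_apply, krausMap_apply, Fintype.sum_prod_type]
    refine Finset.sum_congr rfl fun g _ => ?_
    simp only [Finset.univ_unique, Finset.sum_singleton, smul_kronecker, conjTranspose_smul,
      Matrix.smul_mul, Matrix.mul_smul, smul_smul]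
    congr 1
    simp
    norm_num

/-- Continuity of the Shannon entropy at a point mass. -/
theorem exists_forall_entropy_lt {h : ℝ} (hh : 0 < h) : ∃ ε > 0, ∀ p : Fin 2 × Fin 2 → ℝ,
    (∀ e, 0 ≤ p e) → ∑ e, p e = 1 → 1 - ε < p (0, 0) →
      (∑ e, Real.negMulLog (p e)) / Real.log 2 < h := by
  have hl : 0 < Real.log 2 := Real.log_pos (by norm_num)
  have hc : (0 : ℝ) < h * Real.log 2 / 4 := by positivity
  obtain ⟨δ, hδ, h0⟩ := Metric.continuousAt_iff.1
    (Real.continuous_negMulLog.continuousAt (x := 0)) _ hc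
  obtain ⟨η, hη, h1⟩ := Metric.continuousAt_iff.1
    (Real.continuous_negMulLog.continuousAt (x := 1)) _ hc
  refine ⟨min δ η, lt_min hδ hη, fun p hp hp1 h00 => ?_⟩
  rw [div_lt_iff₀ hl]
  have hle : ∀ e, Real.negMulLog (p e) < h * Real.log 2 / 4 := by
    intro e
    have hsum := Finset.add_sum_erase Finset.univ p (Finset.mem_univ ((0, 0) : Fin 2 × Fin 2))
    rw [hp1] at hsum
    by_cases he : e = (0, 0)
    · subst he
      have hnn : 0 ≤ ∑ x ∈ Finset.univ.erase ((0, 0) : Fin 2 × Fin 2), p x :=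
        Finset.sum_nonneg fun i _ => hp i
      have := h1 (x := p (0, 0)) (by
        rw [Real.dist_eq, abs_lt]
        constructor <;> linarith [min_le_right δ η])
      rw [Real.dist_eq, Real.negMulLog_one, sub_zero] at this
      exact (le_abs_self _).trans_lt this
    · have hnn := Finset.single_le_sum (f := p) (fun i _ => hp i)
        (Finset.mem_erase.2 ⟨he, Finset.mem_univ e⟩)
      have := h0 (x := p e) (by
        rw [Real.dist_eq, abs_lt]
        constructor <;> linarith [min_le_left δ η, hp e])
      rw [Real.dist_eq, Real.negMulLog_zero, sub_zero] at this
      exact (le_abs_self _).trans_lt this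
  calc ∑ e, Real.negMulLog (p e) < ∑ _e : Fin 2 × Fin 2, h * Real.log 2 / 4 :=
        Finset.sum_lt_sum_of_nonempty Finset.univ_nonempty fun e _ => hle e
    _ = h * Real.log 2 := by simp; ring

theorem IsState.tpow {A B : Type} [Fintype A] [DecidableEq A] [Fintype B] [DecidableEq B]
    {ρ : Matrix (A × B) (A × B) ℂ} (hρ : IsState ρ) (J : Type) [Fintype J] [DecidableEq J] :
    IsState (tpow J ρ) := by
  constructor
  · obtain ⟨C, hC⟩ := CStarAlgebra.nonneg_iff_eq_star_mul_self.1 hρ.1.nonneg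
    rw [Matrix.star_eq_conjTranspose] at hC
    set D : Matrix (J → A × B) ((J → A) × (J → B)) ℂ :=
      of fun s x => ∏ j, C (s j) (x.1 j, x.2 j) with hD
    convert Matrix.posSemidef_conjTranspose_mul_self D
    ext x y
    simp only [tpow_apply, hC, Matrix.mul_apply, conjTranspose_apply, Finset.prod_univ_sum,
      Fintype.piFinset_univ, hD, of_apply, star_prod, Finset.prod_mul_distrib]
  · have h := hρ.2
    simp only [Matrix.trace, Matrix.diag_apply] at h ⊢
    calc ∑ x, Distill.tpow J ρ x x = ∑ s : J → A × B, ∏ j, ρ (s j) (s j) :=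
          (Fintype.sum_equiv (Equiv.arrowProdEquivProdArrow J (fun _ => A) (fun _ => B)) _ _
            fun s => rfl).symm
      _ = ∏ _j : J, ∑ a, ρ a a := by rw [Finset.prod_univ_sum, Fintype.piFinset_univ]
      _ = 1 := by simp [h]

theorem SingleDistillable.exists_bellDiagonal {A B : Type} [Fintype A] [DecidableEq A] [Fintype B]
    [DecidableEq B] {ρ : Matrix (A × B) (A × B) ℂ} (hρ : IsState ρ) (hs : SingleDistillable ρ)
    {h : ℝ} (hh : 0 < h) : ∃ (N : ℕ)
      (Λ : Matrix ((Fin N → A) × (Fin N → B)) ((Fin N → A) × (Fin N → B)) ℂ →ₗ[ℂ]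
        Matrix (Fin 2 × Fin 2) (Fin 2 × Fin 2) ℂ),
      1 ≤ N ∧ IsLOCC Λ ∧ IsBellDiagonal (Λ (Distill.tensorPow ρ N)) ∧
        entropy (Λ (Distill.tensorPow ρ N)) < h := by
  obtain ⟨ε, hε, H⟩ := exists_forall_entropy_lt hh
  obtain ⟨r, ⟨N, Λ, hN, hΛ, rfl⟩, hr⟩ := (isGLB_lt_iff hs).1 hε
  have hτ : IsState (Λ (Distill.tensorPow ρ N)) := hΛ.isState (hρ.tpow (Fin N))
  obtain ⟨p, hp, hp1, h00, hconv⟩ := hτ.exists_converts_bellDiagonal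
  obtain ⟨Θ, hΘ, hΘe⟩ := Converts.trans ⟨Λ, hΛ, rfl⟩ hconv
  refine ⟨N, Θ, hN, hΘ, ?_, ?_⟩
  · rw [hΘe]
    refine ⟨fun z x => p (z, x), fun _ _ => hp _, ?_, ?_⟩
    · rw [← hp1, Fintype.sum_prod_type]
    · rw [Fintype.sum_prod_type]
  · rw [hΘe, entropy_bellDiagonal]
    refine H p hp hp1 ?_
    have h1 := re_trace_mul_le_traceNorm
      ((bellProj_posSemidef 0 0).isHermitian.sub hτ.1.isHermitian) (bellProj_posSemidef 0 0)
      (bellProj_le_one 0 0)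
    have h2 := bellProj_mul (0, 0) (0, 0)
    simp only [if_true] at h2
    rw [Matrix.mul_sub, h2, Matrix.trace_sub, trace_bellProj, Complex.sub_re, Complex.one_re] at h1
    rw [h00]
    unfold sigmaPlus at hr ⊢
    linarith

section RandomCodes

open scoped Fin.CommRing

/-! ### Random binary codes -/

section Binary

variable {J : Type} [Fintype J] [DecidableEq J]

theorem add_self_binary (a : J → Fin 2) : a + a = 0 :=
  funext fun j => CharTwo.add_self_eq_zero (a j)

theorem add_eq_zero_iff_binary {a b : J → Fin 2} : a + b = 0 ↔ b = a := by
  rw [← add_self_binary a, add_right_inj]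

theorem eq_zero_or_one_binary (a : Fin 2) : a = 0 ∨ a = 1 := by omega

theorem exists_eq_one_of_ne_zero {a : J → Fin 2} (h : a ≠ 0) : ∃ j, a j = 1 := by
  obtain ⟨j, hj⟩ := Function.ne_iff.1 h
  exact ⟨j, (eq_zero_or_one_binary _).resolve_left hj⟩

/-- If the range of the additive map `φ` together with its translate by `y₀` covers the codomain,
then the fibres of `φ` have density at most twice that of a point. -/
theorem card_fiber_mul_card_le {P Q : Type} [AddCommGroup P] [AddCommGroup Q] [Fintype P]
    [Fintype Q] [DecidableEq Q] (φ : P → Q) (hφ : ∀ a b, φ (a + b) = φ a + φ b) (c y₀ : Q)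
    (g : Q → P) (t : Q → Fin 2) (hg : ∀ y, φ (g y) = y + if t y = 1 then y₀ else 0) :
    (Finset.univ.filter fun a => φ a = c).card * Fintype.card Q ≤ 2 * Fintype.card P := by
  rw [← Finset.card_univ (α := Q), ← Finset.card_product, mul_comm 2]
  have h2 : Fintype.card P * 2 = (Finset.univ : Finset (P × Fin 2)).card := by simp
  rw [h2]
  refine Finset.card_le_card_of_injOn (fun x => (x.1 + g x.2, t x.2)) (fun _ _ => by simp) ?_
  rintro ⟨a, y⟩ ha ⟨b, w⟩ hb hab
  simp only [Finset.coe_product, Finset.coe_filter, Finset.mem_univ, true_and, Set.mem_prod,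
    Set.mem_ofPred_eq, Prod.mk.injEq] at ha hb hab
  have h := congrArg φ hab.1
  rw [hφ, hφ, ha.1, hb.1, hg, hg, hab.2] at h
  have hyw : y = w := add_right_cancel (add_left_cancel h)
  subst hyw
  simpa using hab.1

end Binary

section Code

variable {K L : Type} [Fintype K] [DecidableEq K] [Fintype L] [DecidableEq L]

/-- The hash function `(v, w) ↦ v + T w`. -/
def hashMap (T : Matrix K L (Fin 2)) (s : K ⊕ L → Fin 2) : K → Fin 2 :=
  s ∘ Sum.inl + T *ᵥ (s ∘ Sum.inr)

/-- The dual hash function `(g, h) ↦ h + Tᵀ g`, whose zeros annihilate the kernel of `hashMap T`. -/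
def dualHash (T : Matrix K L (Fin 2)) (g : K ⊕ L → Fin 2) : L → Fin 2 :=
  g ∘ Sum.inr + (g ∘ Sum.inl) ᵥ* T

theorem hashMap_add (T : Matrix K L (Fin 2)) (s t : K ⊕ L → Fin 2) :
    hashMap T (s + t) = hashMap T s + hashMap T t := by
  simp only [hashMap, Pi.add_comp, mulVec_add]
  abel

theorem dualHash_add (T : Matrix K L (Fin 2)) (s t : K ⊕ L → Fin 2) :
    dualHash T (s + t) = dualHash T s + dualHash T t := by
  simp only [dualHash, Pi.add_comp, add_vecMul]
  abel

/-- The code given by the hash function `hashMap T` and the quadratic phase `s ↦ s · B s` detects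
the Pauli error with phase part `c` and flip part `d`. -/
def Detects (T : Matrix K L (Fin 2)) (B : Matrix (K ⊕ L) (K ⊕ L) (Fin 2))
    (c d : K ⊕ L → Fin 2) : Prop :=
  ∃ a, hashMap T a = 0 ∧ a ⬝ᵥ (c + (B + Bᵀ) *ᵥ d) = 1

theorem dualHash_eq_zero_of_not_detects {T : Matrix K L (Fin 2)}
    {B : Matrix (K ⊕ L) (K ⊕ L) (Fin 2)} {c d : K ⊕ L → Fin 2} (h : ¬ Detects T B c d) :
    dualHash T (c + (B + Bᵀ) *ᵥ d) = 0 := by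
  by_contra h0
  obtain ⟨l, hl⟩ := exists_eq_one_of_ne_zero h0
  refine h ⟨Sum.elim (T *ᵥ Pi.single l 1) (Pi.single l 1), ?_, ?_⟩
  · simp [hashMap, add_self_binary]
  · refine Eq.trans ?_ hl
    generalize c + (B + Bᵀ) *ᵥ d = g
    simp [dotProduct, dualHash, vecMul, Fintype.sum_sum_type, Pi.single_apply, mul_comm, add_comm]

/-- For a uniformly random code the dual hash value, which is `0` whenever a given nontrivial error
is not detected, is `0` with probability at most `2 / 2 ^ |L|`. The factor `2` is due to the fact
that `B + Bᵀ` is alternating, so that `(B + Bᵀ) d` only ranges over the hyperplane `d^⊥`. -/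
theorem card_not_detects_le {c d : K ⊕ L → Fin 2} (hcd : c ≠ 0 ∨ d ≠ 0) :
    (Finset.univ.filter fun θ : Matrix K L (Fin 2) × Matrix (K ⊕ L) (K ⊕ L) (Fin 2) =>
      dualHash θ.1 (c + (θ.2 + θ.2ᵀ) *ᵥ d) = 0).card * 2 ^ Fintype.card L ≤
    2 * Fintype.card (Matrix K L (Fin 2) × Matrix (K ⊕ L) (K ⊕ L) (Fin 2)) := by
  have hQ : Fintype.card (L → Fin 2) = 2 ^ Fintype.card L := by simp
  rw [← hQ, Finset.card_filter, Fintype.card_prod]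
  by_cases hd : d = 0
  · have hc : c ≠ 0 := hcd.resolve_right (not_not.2 hd)
    subst hd
    simp only [mulVec_zero, add_zero]
    have hconst : (∑ θ : Matrix K L (Fin 2) × Matrix (K ⊕ L) (K ⊕ L) (Fin 2),
        if dualHash θ.1 c = 0 then 1 else 0) = Fintype.card (Matrix (K ⊕ L) (K ⊕ L) (Fin 2)) *
          (Finset.univ.filter fun T : Matrix K L (Fin 2) => dualHash T c = 0).card := by
      rw [Finset.card_filter, Fintype.sum_prod_type_right]
      exact Finset.sum_const (s := (Finset.univ : Finset (Matrix (K ⊕ L) (K ⊕ L) (Fin 2))))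
        (∑ T : Matrix K L (Fin 2), if dualHash T c = 0 then 1 else 0)
    rw [hconst]
    suffices H : (Finset.univ.filter fun T : Matrix K L (Fin 2) => dualHash T c = 0).card *
        Fintype.card (L → Fin 2) ≤ 2 * Fintype.card (Matrix K L (Fin 2)) by
      calc _ = Fintype.card (Matrix (K ⊕ L) (K ⊕ L) (Fin 2)) *
            ((Finset.univ.filter fun T : Matrix K L (Fin 2) => dualHash T c = 0).card *
              Fintype.card (L → Fin 2)) := by ring
        _ ≤ Fintype.card (Matrix (K ⊕ L) (K ⊕ L) (Fin 2)) *
            (2 * Fintype.card (Matrix K L (Fin 2))) := Nat.mul_le_mul_left _ H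
        _ = _ := by ring
    by_cases hi : c ∘ Sum.inl = 0
    · have : (Finset.univ.filter fun T : Matrix K L (Fin 2) => dualHash T c = 0) = ∅ := by
        refine Finset.filter_eq_empty_iff.2 fun T _ hT => hc ?_
        rw [dualHash, hi, zero_vecMul, add_zero] at hT
        rw [← Sum.elim_comp_inl_inr c, hi, hT]
        exact Sum.elim_zero_zero
      simp [this]
    · obtain ⟨i, hi⟩ := exists_eq_one_of_ne_zero hi
      have := card_fiber_mul_card_le (fun T : Matrix K L (Fin 2) => (c ∘ Sum.inl) ᵥ* T)
        (fun T T' => vecMul_add _ _ _) (c ∘ Sum.inr) 0 (fun y => vecMulVec (Pi.single i 1) y)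
        (fun _ => 0) (fun y => by
          simp only [vecMul_vecMulVec, dotProduct_single_one, hi]
          simp)
      simpa only [dualHash, add_eq_zero_iff_binary] using this
  · obtain ⟨i, hi⟩ := exists_eq_one_of_ne_zero hd
    rw [Fintype.sum_prod_type, Finset.sum_mul]
    have H : ∀ T : Matrix K L (Fin 2),
        (∑ B : Matrix (K ⊕ L) (K ⊕ L) (Fin 2),
          if dualHash T (c + (B + Bᵀ) *ᵥ d) = 0 then 1 else 0) * Fintype.card (L → Fin 2) ≤
        2 * Fintype.card (Matrix (K ⊕ L) (K ⊕ L) (Fin 2)) := by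
      intro T
      rw [← Finset.card_filter]
      -- adding `b eᵢᵀ` to `B`, where `d i = 1`, adds `b + (b · d) eᵢ` to `(B + Bᵀ) d`
      have := card_fiber_mul_card_le
        (fun B : Matrix (K ⊕ L) (K ⊕ L) (Fin 2) => dualHash T ((B + Bᵀ) *ᵥ d))
        (fun B B' => by
          rw [← dualHash_add, ← add_mulVec, transpose_add]
          congr 2
          abel) (dualHash T c) (dualHash T (Pi.single i 1))
        (fun y => vecMulVec (Sum.elim 0 y) (Pi.single i 1)) (fun y => Sum.elim 0 y ⬝ᵥ d)
        (fun y => by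
          have h1 : dualHash T (Sum.elim 0 y) = y := by simp [dualHash]
          rw [transpose_vecMulVec, add_mulVec, vecMulVec_mulVec, vecMulVec_mulVec,
            single_one_dotProduct, hi, dualHash_add]
          simp only [MulOpposite.op_one, one_smul, h1]
          congr 1
          rcases eq_zero_or_one_binary (Sum.elim 0 y ⬝ᵥ d) with h | h
          · simp [h, dualHash]
          · simp [h])
      simpa only [dualHash_add T c, add_eq_zero_iff_binary] using this
    calc _ ≤ ∑ _T : Matrix K L (Fin 2), 2 * Fintype.card (Matrix (K ⊕ L) (K ⊕ L) (Fin 2)) :=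
          Finset.sum_le_sum fun T _ => H T
      _ = _ := by simp; ring

/-- Averaging over a random code `θ`: if any two errors are confused by at most a fraction `2 / D`
of the codes, then for some code the errors in `S` that are confused with another error in `S` have
total probability at most `2 |S| / D`. -/
theorem exists_sum_bad_le {Θ E : Type} [Fintype Θ] [Nonempty Θ] [Fintype E] [DecidableEq E]
    (S : Finset E) (p : E → ℝ) (hp : ∀ e, 0 ≤ p e) (hp1 : ∑ e, p e = 1)
    (Bad : Θ → E → E → Prop) [∀ θ e f, Decidable (Bad θ e f)] (D : ℕ) (hD : 0 < D)
    (h : ∀ e f, e ≠ f → (Finset.univ.filter fun θ => Bad θ e f).card * D ≤ 2 * Fintype.card Θ) :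
    ∃ θ, ∑ e ∈ S with ∃ f ∈ S, e ≠ f ∧ Bad θ e f, p e ≤ 2 * S.card / D := by
  have hD' : (0 : ℝ) < D := by exact_mod_cast hD
  have h1 : ∀ θ, ∑ e ∈ S with ∃ f ∈ S, e ≠ f ∧ Bad θ e f, p e ≤
      ∑ e ∈ S, p e * ∑ f ∈ S with e ≠ f, if Bad θ e f then 1 else 0 := by
    intro θ
    rw [Finset.sum_filter]
    refine Finset.sum_le_sum fun e _ => ?_
    split_ifs with hb
    · obtain ⟨f, hf, hef, hb⟩ := hb
      refine le_mul_of_one_le_right (hp e) ?_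
      have := Finset.single_le_sum (s := S.filter fun f => e ≠ f)
        (f := fun f => if Bad θ e f then (1 : ℝ) else 0) (fun f _ => by split_ifs <;> norm_num)
        (Finset.mem_filter.2 ⟨hf, hef⟩)
      simpa [hb] using this
    · exact mul_nonneg (hp e) (Finset.sum_nonneg fun f _ => by split_ifs <;> norm_num)
  have h2 : ∑ θ, ∑ e ∈ S with ∃ f ∈ S, e ≠ f ∧ Bad θ e f, p e ≤
      ∑ _θ : Θ, (2 * S.card / D : ℝ) := by
    calc _ ≤ ∑ θ, ∑ e ∈ S, p e * ∑ f ∈ S with e ≠ f, if Bad θ e f then 1 else 0 :=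
          Finset.sum_le_sum fun θ _ => h1 θ
      _ = ∑ e ∈ S, p e * ∑ f ∈ S with e ≠ f, ∑ θ, if Bad θ e f then 1 else 0 := by
          rw [Finset.sum_comm]
          refine Finset.sum_congr rfl fun e _ => ?_
          rw [← Finset.mul_sum, Finset.sum_comm]
      _ ≤ ∑ e ∈ S, p e * (S.card * (2 * Fintype.card Θ / D)) := by
          refine Finset.sum_le_sum fun e _ => mul_le_mul_of_nonneg_left ?_ (hp e)
          calc _ ≤ ∑ f ∈ S with e ≠ f, (2 * Fintype.card Θ / D : ℝ) := by
                refine Finset.sum_le_sum fun f hf => ?_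
                rw [le_div_iff₀ hD', Finset.sum_boole]
                exact_mod_cast h e f (Finset.mem_filter.1 hf).2
            _ ≤ _ := by
                rw [Finset.sum_const, nsmul_eq_mul]
                gcongr
                exact Finset.filter_subset _ _
      _ = (∑ e ∈ S, p e) * (S.card * (2 * Fintype.card Θ / D)) := by rw [Finset.sum_mul]
      _ ≤ 1 * (S.card * (2 * Fintype.card Θ / D)) := by
          gcongr
          rw [← hp1]
          exact Finset.sum_le_univ_sum_of_nonneg hp
      _ = _ := by simp; ring
  obtain ⟨θ, _, hθ⟩ := Finset.exists_le_of_sum_le Finset.univ_nonempty h2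
  exact ⟨θ, hθ⟩

end Code

/-! ### Strings of Bell states -/

section Sign

/-- The nontrivial character of `ℤ/2`, with complex values. -/
def sgn (a : Fin 2) : ℂ := (-1) ^ a.val

theorem sgn_zero : sgn 0 = 1 := by simp [sgn]

theorem sgn_one : sgn 1 = -1 := by simp [sgn]

theorem sgn_add (a b : Fin 2) : sgn (a + b) = sgn a * sgn b := by
  fin_cases a <;> fin_cases b <;> simp [sgn]

theorem sgn_mul_self (a : Fin 2) : sgn a * sgn a = 1 := by
  rw [← sgn_add, CharTwo.add_self_eq_zero, sgn_zero]

theorem star_sgn (a : Fin 2) : star (sgn a) = sgn a := by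
  fin_cases a <;> simp [sgn]

theorem sgn_sum {J : Type} (s : Finset J) (f : J → Fin 2) :
    sgn (∑ j ∈ s, f j) = ∏ j ∈ s, sgn (f j) := by
  classical
  induction s using Finset.induction_on with
  | empty => simp [sgn_zero]
  | insert j s hj ih => rw [Finset.sum_insert hj, Finset.prod_insert hj, sgn_add, ih]

theorem sum_sgn_dotProduct {J : Type} [Fintype J] [DecidableEq J] (v : J → Fin 2) :
    ∑ z : J → Fin 2, sgn (z ⬝ᵥ v) = if v = 0 then 2 ^ Fintype.card J else 0 := by
  split_ifs with h
  · simp [h, sgn_zero]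
  · obtain ⟨j, hj⟩ := exists_eq_one_of_ne_zero h
    -- flipping the coordinate `j` of `z` changes the sign of the summand
    have := Fintype.sum_equiv (Equiv.addRight (Pi.single j 1 : J → Fin 2))
      (fun z => -sgn (z ⬝ᵥ v)) (fun z => sgn (z ⬝ᵥ v)) fun z => by
        simp [add_dotProduct, sgn_add, hj, sgn_one]
    rw [Finset.sum_neg_distrib] at this
    exact self_eq_neg.1 this.symm

end Sign

/-- The amplitude `1/√2`. -/
def rt : ℂ := (Real.sqrt 2 : ℂ)⁻¹

theorem rt_mul_self : rt * rt = 1 / 2 := inv_sqrt_two_mul_self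

theorem star_rt : star rt = rt := by simp [rt]

theorem rt_pow_mul_self (n : ℕ) : rt ^ n * rt ^ n * 2 ^ n = 1 := by
  rw [← mul_pow, rt_mul_self, ← mul_pow]
  norm_num

section BellString

variable {J : Type} [Fintype J] [DecidableEq J]

/-- The tensor product of the Bell vectors with the labels `e j`, with the phase bits `(e j).1` and
the flip bits `(e j).2`. -/
def bellString (e : J → Fin 2 × Fin 2) : (J → Fin 2) × (J → Fin 2) → ℂ :=
  fun s => if s.2 = s.1 + Prod.snd ∘ e then
    rt ^ Fintype.card J * sgn ((Prod.fst ∘ e) ⬝ᵥ s.1) else 0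

theorem prod_bellVec (e : J → Fin 2 × Fin 2) (s : (J → Fin 2) × (J → Fin 2)) :
    ∏ j, bellVec (e j).1 (e j).2 (s.1 j, s.2 j) = bellString e s := by
  have h : ∀ z a : Fin 2, ((-1 : ℂ)) ^ (z.val * a.val) = sgn (z * a) := by
    intro z a
    fin_cases z <;> fin_cases a <;> simp [sgn]
  simp only [bellVec, h, bellString]
  split_ifs with hs
  · rw [dotProduct, sgn_sum, ← Finset.card_univ, ← Finset.prod_const, ← Finset.prod_mul_distrib]
    refine Finset.prod_congr rfl fun j _ => ?_
    exact (if_pos (congrFun hs j)).trans (div_eq_inv_mul _ _)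
  · obtain ⟨j, hj⟩ := Function.ne_iff.1 hs
    exact Finset.prod_eq_zero (Finset.mem_univ j) (if_neg hj)

theorem tpow_bellProj (z x : Fin 2) :
    tpow J (bellProj z x) = vecMulVec (bellString fun _ : J => (z, x))
      (star (bellString fun _ : J => (z, x))) := by
  ext s t
  rw [tpow_apply, vecMulVec_apply, Pi.star_apply, ← prod_bellVec, ← prod_bellVec, star_prod,
    ← Finset.prod_mul_distrib]
  rfl

/-- A tensor power of a Bell-diagonal state is a mixture of strings of Bell states. -/
theorem tpow_bellDiagonal (p : Fin 2 × Fin 2 → ℝ) :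
    tpow J (∑ e : Fin 2 × Fin 2, (p e : ℂ) • bellProj e.1 e.2) =
      ∑ e : J → Fin 2 × Fin 2, ((∏ j, p (e j) : ℝ) : ℂ) •
        vecMulVec (bellString e) (star (bellString e)) := by
  ext s t
  simp only [tpow_apply, Matrix.sum_apply, Matrix.smul_apply, Finset.prod_univ_sum,
    Fintype.piFinset_univ, smul_eq_mul, Finset.prod_mul_distrib, Complex.ofReal_prod]
  refine Finset.sum_congr rfl fun e _ => ?_
  congr 1
  rw [vecMulVec_apply, Pi.star_apply, ← prod_bellVec, ← prod_bellVec, star_prod,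
    ← Finset.prod_mul_distrib]
  rfl

theorem kronecker_mulVec_apply {m n m' n' : Type} [Fintype n] [Fintype n'] (K : Matrix m n ℂ)
    (L : Matrix m' n' ℂ) (v : n × n' → ℂ) (u : m × m') :
    ((K ⊗ₖ L) *ᵥ v) u = ∑ s, ∑ t, K u.1 s * L u.2 t * v (s, t) := by
  simp [mulVec, dotProduct, Fintype.sum_prod_type]

end BellString

/-! ### Decoding -/

section Decoding

variable {K L : Type} [Fintype K] [DecidableEq K] [Fintype L] [DecidableEq L]

/-- The quadratic form of the phases of a code. -/
def quad (B : Matrix (K ⊕ L) (K ⊕ L) (Fin 2)) (s : K ⊕ L → Fin 2) : Fin 2 := s ⬝ᵥ B *ᵥ s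

theorem quad_add (B : Matrix (K ⊕ L) (K ⊕ L) (Fin 2)) (s a : K ⊕ L → Fin 2) :
    quad B (s + a) = quad B s + quad B a + a ⬝ᵥ (B + Bᵀ) *ᵥ s := by
  have h : s ⬝ᵥ B *ᵥ a = a ⬝ᵥ Bᵀ *ᵥ s := by
    rw [dotProduct_mulVec, dotProduct_comm, mulVec_transpose]
  simp only [quad, add_dotProduct, mulVec_add, dotProduct_add, h, add_mulVec]
  ring

/-- The adjoint of the encoding isometry of the code given by `T` and `B`: the code word with
label `u` is the superposition of the basis vectors `s` with `hashMap T s = u`, with the phases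
`(-1) ^ (s · B s)`. -/
def codeMat (T : Matrix K L (Fin 2)) (B : Matrix (K ⊕ L) (K ⊕ L) (Fin 2)) :
    Matrix (K → Fin 2) (K ⊕ L → Fin 2) ℂ :=
  of fun u s => if hashMap T s = u then rt ^ Fintype.card L * sgn (quad B s) else 0

/-- Alice's Kraus operators: she applies a random phase flip `z` and projects onto the code. -/
def aliceKraus (T : Matrix K L (Fin 2)) (B : Matrix (K ⊕ L) (K ⊕ L) (Fin 2))
    (z : K ⊕ L → Fin 2) : Matrix (K → Fin 2) (K ⊕ L → Fin 2) ℂ :=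
  of fun u s => rt ^ Fintype.card K * (codeMat T B u s * sgn (z ⬝ᵥ s))

/-- Bob's Kraus operators: being told Alice's outcome `z`, he undoes the error `e`, applies the same
phase flip `z` and projects onto the code. -/
def bobKraus (T : Matrix K L (Fin 2)) (B : Matrix (K ⊕ L) (K ⊕ L) (Fin 2))
    (z : K ⊕ L → Fin 2) (e : K ⊕ L → Fin 2 × Fin 2) :
    Matrix (K → Fin 2) (K ⊕ L → Fin 2) ℂ :=
  of fun u r => codeMat T B u (r + Prod.snd ∘ e) *
    sgn ((z + Prod.fst ∘ e) ⬝ᵥ (r + Prod.snd ∘ e))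

variable (T : Matrix K L (Fin 2)) (B : Matrix (K ⊕ L) (K ⊕ L) (Fin 2))

theorem star_codeMat (u : K → Fin 2) (s : K ⊕ L → Fin 2) :
    star (codeMat T B u s) = codeMat T B u s := by
  simp only [codeMat, of_apply]
  split_ifs
  · rw [star_mul', star_sgn, star_pow, star_rt]
  · exact star_zero _

theorem star_bobKraus (z : K ⊕ L → Fin 2) (e : K ⊕ L → Fin 2 × Fin 2) (u : K → Fin 2)
    (r : K ⊕ L → Fin 2) : star (bobKraus T B z e u r) = bobKraus T B z e u r := by
  simp only [bobKraus, of_apply, star_mul', star_codeMat, star_sgn]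

theorem sum_codeMat_mul (u u' : K → Fin 2) :
    ∑ s, codeMat T B u s * codeMat T B u' s = if u = u' then 1 else 0 := by
  have h : ∀ s, codeMat T B u s * codeMat T B u' s = if hashMap T s = u then
      (if u = u' then rt ^ Fintype.card L * rt ^ Fintype.card L else 0) else 0 := by
    intro s
    simp only [codeMat, of_apply]
    split_ifs with h1 h2 h3 h3 h2
    · rw [mul_mul_mul_comm, sgn_mul_self, mul_one]
    · exact absurd (h1.symm.trans h2) h3
    · exact absurd (h1.trans h3) h2
    · simp
    · simp
    · simp
  simp only [h]
  have hsplit := Fintype.sum_equiv (Equiv.sumArrowEquivProdArrow K L (Fin 2))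
    (fun s => if hashMap T s = u then
      (if u = u' then rt ^ Fintype.card L * rt ^ Fintype.card L else 0) else 0)
    (fun x => if x.1 + T *ᵥ x.2 = u then
      (if u = u' then rt ^ Fintype.card L * rt ^ Fintype.card L else 0) else 0) fun s => rfl
  rw [hsplit, Fintype.sum_prod_type_right]
  simp only [← eq_sub_iff_add_eq]
  simp only [Finset.sum_ite_eq', Finset.mem_univ, if_true]
  split_ifs with hu
  · simp only [Finset.sum_const, Finset.card_univ, Fintype.card_fun, Fintype.card_fin,
      nsmul_eq_mul]
    push_cast
    rw [mul_comm, rt_pow_mul_self]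
  · simp

/-- Averaging over the phase flips removes the off-diagonal entries of the projector onto the code,
whose diagonal is constant. -/
theorem aliceKraus_instrument : ∑ z, (aliceKraus T B z)ᴴ * aliceKraus T B z = 1 := by
  ext s s'
  have h : ∀ z u, star (aliceKraus T B z u s) * aliceKraus T B z u s' =
      (rt ^ Fintype.card K * rt ^ Fintype.card K) * (codeMat T B u s * codeMat T B u s') *
        sgn (z ⬝ᵥ (s + s')) := by
    intro z u
    simp only [aliceKraus, of_apply, star_mul', star_codeMat, star_sgn, star_pow, star_rt,
      dotProduct_add, sgn_add]
    ring
  simp only [Matrix.sum_apply, Matrix.mul_apply, conjTranspose_apply, h]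
  rw [Finset.sum_comm]
  simp only [← Finset.mul_sum, sum_sgn_dotProduct, add_eq_zero_iff_binary]
  rw [Matrix.one_apply]
  split_ifs with h1 h2 h2
  · subst h1
    have h3 : ∀ u, codeMat T B u s' * codeMat T B u s' = if hashMap T s' = u then
        rt ^ Fintype.card L * rt ^ Fintype.card L else 0 := by
      intro u
      simp only [codeMat, of_apply]
      split_ifs
      · rw [mul_mul_mul_comm, sgn_mul_self, mul_one]
      · simp
    rw [← Finset.sum_mul, ← Finset.mul_sum]
    simp only [h3, Finset.sum_ite_eq, Finset.mem_univ, if_true, Fintype.card_sum, pow_add]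
    linear_combination (rt ^ Fintype.card L * rt ^ Fintype.card L * 2 ^ Fintype.card L) *
      rt_pow_mul_self (Fintype.card K) + rt_pow_mul_self (Fintype.card L)
  · exact absurd h1.symm h2
  · exact absurd h2.symm h1
  · simp

theorem bobKraus_mul_self (z : K ⊕ L → Fin 2) (e : K ⊕ L → Fin 2 × Fin 2) :
    bobKraus T B z e * (bobKraus T B z e)ᴴ = 1 := by
  ext u u'
  simp only [Matrix.mul_apply, conjTranspose_apply, star_bobKraus]
  rw [Matrix.one_apply, ← sum_codeMat_mul T B u u']
  refine Fintype.sum_equiv (Equiv.addRight (Prod.snd ∘ e)) _ _ fun r => ?_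
  simp only [bobKraus, of_apply, Equiv.coe_addRight]
  rw [mul_mul_mul_comm, sgn_mul_self, mul_one]

/-- Distinct errors `e` and `f` move the code into orthogonal subspaces if the code detects their
difference. -/
theorem bobKraus_mul_of_detects (z : K ⊕ L → Fin 2) {e f : K ⊕ L → Fin 2 × Fin 2}
    (h : Detects T B (Prod.fst ∘ e + Prod.fst ∘ f) (Prod.snd ∘ e + Prod.snd ∘ f)) :
    bobKraus T B z e * (bobKraus T B z f)ᴴ = 0 := by
  obtain ⟨a, ha, ha1⟩ := h
  ext u u'
  simp only [Matrix.mul_apply, conjTranspose_apply, star_bobKraus, Matrix.zero_apply]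
  -- the shift of the summation variable by `a` changes the sign of the sum
  have hshift := Fintype.sum_equiv (Equiv.addRight a)
      (fun r => -(bobKraus T B z e u r * bobKraus T B z f u' r))
      (fun r => bobKraus T B z e u r * bobKraus T B z f u' r) fun r => by
    have hfac : ∀ e u, bobKraus T B z e u (r + a) = bobKraus T B z e u r *
        sgn (quad B a + a ⬝ᵥ (B + Bᵀ) *ᵥ (r + Prod.snd ∘ e) + (z + Prod.fst ∘ e) ⬝ᵥ a) := by
      intro e u
      have hr : r + a + Prod.snd ∘ e = (r + Prod.snd ∘ e) + a := by abel
      simp only [bobKraus, codeMat, of_apply, hr]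
      generalize r + Prod.snd ∘ e = s
      rw [hashMap_add, ha, add_zero, quad_add, dotProduct_add]
      simp only [sgn_add]
      split_ifs <;> ring
    simp only [Equiv.coe_addRight]
    rw [hfac, hfac, mul_mul_mul_comm, ← sgn_add]
    have hone : quad B a + a ⬝ᵥ (B + Bᵀ) *ᵥ (r + Prod.snd ∘ e) + (z + Prod.fst ∘ e) ⬝ᵥ a +
        (quad B a + a ⬝ᵥ (B + Bᵀ) *ᵥ (r + Prod.snd ∘ f) + (z + Prod.fst ∘ f) ⬝ᵥ a) = 1 := by
      rw [← ha1]
      simp only [dotProduct_comm _ a, mulVec_add, dotProduct_add]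
      linear_combination CharTwo.add_self_eq_zero (quad B a) +
        CharTwo.add_self_eq_zero (a ⬝ᵥ (B + Bᵀ) *ᵥ r) + CharTwo.add_self_eq_zero (a ⬝ᵥ z)
    rw [hone, sgn_one]
    ring
  rw [Finset.sum_neg_distrib] at hshift
  exact self_eq_neg.1 hshift.symm

/-- If Bob guesses the error `e` correctly, then the two parties are left with a maximally entangled
state. The norm of the resulting vector does not depend on `z` or `e`. -/
theorem aliceKraus_bobKraus_mulVec (z : K ⊕ L → Fin 2) (e : K ⊕ L → Fin 2 × Fin 2) :
    (aliceKraus T B z ⊗ₖ bobKraus T B z e) *ᵥ bellString e =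
      rt ^ Fintype.card (K ⊕ L) • bellString fun _ : K => (0, 0) := by
  ext u
  rw [kronecker_mulVec_apply]
  have h : ∀ s, ∑ t, aliceKraus T B z u.1 s * bobKraus T B z e u.2 t * bellString e (s, t) =
      rt ^ Fintype.card K * rt ^ Fintype.card (K ⊕ L) *
        (bobKraus T B z e u.1 (s + Prod.snd ∘ e) * star (bobKraus T B z e u.2 (s + Prod.snd ∘ e)))
      := by
    intro s
    rw [Finset.sum_eq_single (s + Prod.snd ∘ e)]
    · rw [star_bobKraus]
      have hs : s + Prod.snd ∘ e + Prod.snd ∘ e = s := by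
        rw [add_assoc, add_self_binary, add_zero]
      simp only [bellString, if_true, aliceKraus, bobKraus, of_apply, hs, add_dotProduct, sgn_add]
      ring
    · intro t _ ht
      simp [bellString, ht]
    · simp
  simp only [h, ← Finset.mul_sum]
  have h1 := congrFun (congrFun (bobKraus_mul_self T B z e) u.1) u.2
  simp only [Matrix.mul_apply, conjTranspose_apply] at h1
  have hshift := Fintype.sum_equiv (Equiv.addRight (Prod.snd ∘ e))
    (fun s => bobKraus T B z e u.1 (s + Prod.snd ∘ e) *
      star (bobKraus T B z e u.2 (s + Prod.snd ∘ e)))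
    (fun r => bobKraus T B z e u.1 r * star (bobKraus T B z e u.2 r)) fun s => rfl
  rw [hshift, h1, Matrix.one_apply]
  simp only [Pi.smul_apply, bellString, smul_eq_mul]
  have h0 : Prod.snd ∘ (fun _ : K => ((0, 0) : Fin 2 × Fin 2)) = 0 := rfl
  have h0' : Prod.fst ∘ (fun _ : K => ((0, 0) : Fin 2 × Fin 2)) = 0 := rfl
  simp only [h0, h0', add_zero, zero_dotProduct, sgn_zero, mul_one, eq_comm (a := u.2)]
  split_ifs <;> ring

/-- Operators `C e` whose rows form, all together, an orthonormal family can be completed to the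
Kraus operators of a channel. -/
theorem exists_kraus_completion {S m n : Type} [Fintype S] [DecidableEq S] [Fintype m]
    [DecidableEq m] [Nonempty m] [Fintype n] [DecidableEq n] (C : S → Matrix m n ℂ)
    (hC : ∀ e f, C e * (C f)ᴴ = if e = f then 1 else 0) :
    ∃ D : n → Matrix m n ℂ, ∑ k : S ⊕ n, (Sum.elim C D k)ᴴ * Sum.elim C D k = 1 := by
  set P := ∑ e, (C e)ᴴ * C e with hP
  have hPP : P * P = P := by
    rw [hP, Finset.sum_mul]
    refine Finset.sum_congr rfl fun e _ => ?_
    rw [Finset.mul_sum, Finset.sum_eq_single e]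
    · rw [Matrix.mul_assoc, ← Matrix.mul_assoc (C e), hC, if_pos rfl, Matrix.one_mul]
    · intro f _ hf
      rw [Matrix.mul_assoc, ← Matrix.mul_assoc (C e), hC, if_neg hf.symm, Matrix.zero_mul,
        Matrix.mul_zero]
    · simp
  have hPs : Pᴴ = P := by simp [hP, conjTranspose_sum]
  obtain ⟨c⟩ := ‹Nonempty m›
  refine ⟨fun g => Matrix.single c g (1 : ℂ) * (1 - P), ?_⟩
  have h1 : ∑ g : n, (Matrix.single c g (1 : ℂ))ᴴ * Matrix.single c g (1 : ℂ) = 1 := by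
    ext a b
    simp [Matrix.sum_apply, Matrix.single_apply, Matrix.one_apply, conjTranspose_single, ite_and]
  have h2 : ∑ g : n, (Matrix.single c g (1 : ℂ) * (1 - P))ᴴ * (Matrix.single c g (1 : ℂ) * (1 - P)) =
      1 - P := by
    have : ∀ g : n, (Matrix.single c g (1 : ℂ) * (1 - P))ᴴ * (Matrix.single c g (1 : ℂ) * (1 - P)) =
        (1 - P) * ((Matrix.single c g (1 : ℂ))ᴴ * Matrix.single c g (1 : ℂ)) * (1 - P) := by
      intro g
      rw [conjTranspose_mul, conjTranspose_sub, conjTranspose_one, hPs]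
      simp only [Matrix.mul_assoc]
    simp only [this]
    rw [← Finset.sum_mul, ← Finset.mul_sum, h1, Matrix.mul_one, Matrix.sub_mul, Matrix.mul_sub,
      Matrix.mul_sub, hPP]
    simp
  rw [Fintype.sum_sum_type]
  simp only [Sum.elim_inl, Sum.elim_inr]
  rw [h2, ← hP]
  simp

end Decoding

section Protocol

variable {K L : Type} [Fintype K] [DecidableEq K] [Fintype L] [DecidableEq L]

theorem conj_mono {m n : Type} [Fintype m] [Fintype n] {X Y : Matrix m m ℂ} (h : X ≤ Y)
    (M : Matrix n m ℂ) : M * X * Mᴴ ≤ M * Y * Mᴴ := by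
  rw [Matrix.le_iff, ← Matrix.sub_mul, ← Matrix.mul_sub]
  exact (Matrix.le_iff.1 h).mul_mul_conjTranspose_same M

theorem conj_nonneg {m n : Type} [Fintype m] [Fintype n] {X : Matrix m m ℂ} (h : X.PosSemidef)
    (M : Matrix n m ℂ) : 0 ≤ M * X * Mᴴ :=
  (h.mul_mul_conjTranspose_same M).nonneg

theorem trace_tpow_sigmaPlus : (tpow K sigmaPlus).trace = 1 :=
  (IsState.tpow ⟨bellProj_posSemidef 0 0, trace_bellProj 0 0⟩ K).2

theorem alice_bob_conj (T : Matrix K L (Fin 2)) (B : Matrix (K ⊕ L) (K ⊕ L) (Fin 2))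
    (z : K ⊕ L → Fin 2) (e : K ⊕ L → Fin 2 × Fin 2) :
    (aliceKraus T B z ⊗ₖ bobKraus T B z e) * vecMulVec (bellString e) (star (bellString e)) *
      (aliceKraus T B z ⊗ₖ bobKraus T B z e)ᴴ =
    ((1 / 2 : ℂ) ^ Fintype.card (K ⊕ L)) • tpow K sigmaPlus := by
  rw [mul_vecMulVec, vecMulVec_mul, ← star_mulVec, aliceKraus_bobKraus_mulVec, sigmaPlus,
    tpow_bellProj, star_smul, smul_vecMulVec, vecMulVec_smul, smul_smul, star_pow, star_rt,
    ← mul_pow, rt_mul_self]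

/-- If the errors in `S` are pairwise distinguished by the code, then the one-way protocol that
decodes them turns a state containing `e ∈ S` with weight `p e` into one that contains the
maximally entangled state with weight `∑ e ∈ S, p e`. -/
theorem exists_isLOCC_traceNorm_le (T : Matrix K L (Fin 2))
    (B : Matrix (K ⊕ L) (K ⊕ L) (Fin 2)) (S : Finset (K ⊕ L → Fin 2 × Fin 2))
    (hS : ∀ e ∈ S, ∀ f ∈ S, e ≠ f →
      Detects T B (Prod.fst ∘ e + Prod.fst ∘ f) (Prod.snd ∘ e + Prod.snd ∘ f))
    (p : (K ⊕ L → Fin 2 × Fin 2) → ℝ)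
    {τ : Matrix ((K ⊕ L → Fin 2) × (K ⊕ L → Fin 2)) ((K ⊕ L → Fin 2) × (K ⊕ L → Fin 2)) ℂ}
    (hτ : IsState τ)
    (hp : ∀ e ∈ S, (p e : ℂ) • vecMulVec (bellString e) (star (bellString e)) ≤ τ)
    (hp1 : ∑ e ∈ S, p e ≤ 1) :
    ∃ Λ : Matrix ((K ⊕ L → Fin 2) × (K ⊕ L → Fin 2)) ((K ⊕ L → Fin 2) × (K ⊕ L → Fin 2)) ℂ →ₗ[ℂ]
        Matrix ((K → Fin 2) × (K → Fin 2)) ((K → Fin 2) × (K → Fin 2)) ℂ,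
      IsLOCC Λ ∧ traceNorm (tpow K sigmaPlus - Λ τ) ≤ 2 * (1 - ∑ e ∈ S, p e) := by
  have hD : ∀ z, ∃ D : (K ⊕ L → Fin 2) → Matrix (K → Fin 2) (K ⊕ L → Fin 2) ℂ,
      ∑ k : S ⊕ (K ⊕ L → Fin 2), (Sum.elim (fun e : S => bobKraus T B z e) D k)ᴴ *
        Sum.elim (fun e : S => bobKraus T B z e) D k = 1 := fun z =>
    exists_kraus_completion _ fun e f => by
      split_ifs with h
      · rw [h, bobKraus_mul_self]
      · exact bobKraus_mul_of_detects T B z (hS e e.2 f f.2 fun h' => h (Subtype.ext h'))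
  choose D hD using hD
  set Λ := krausMap fun x : (K ⊕ L → Fin 2) × (S ⊕ (K ⊕ L → Fin 2)) =>
    aliceKraus T B x.1 ⊗ₖ Sum.elim (fun e : S => bobKraus T B x.1 e) (D x.1) x.2 with hΛdef
  have hΛ : IsLOCC Λ := IsLOCC.oneWay (aliceKraus T B)
    (aliceKraus_instrument T B) (fun z => Sum.elim (fun e : S => bobKraus T B z e) (D z)) hD
  have hle : ((∑ e ∈ S, p e : ℝ) : ℂ) • tpow K sigmaPlus ≤ Λ τ := by
    calc ((∑ e ∈ S, p e : ℝ) : ℂ) • tpow K sigmaPlus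
        = ∑ z : K ⊕ L → Fin 2, ∑ e : S, (p e : ℂ) •
            (((1 / 2 : ℂ) ^ Fintype.card (K ⊕ L)) • tpow K sigmaPlus) := by
          rw [← Finset.sum_smul, Finset.sum_const, Finset.card_univ, ← Nat.cast_smul_eq_nsmul ℂ,
            smul_smul, smul_smul, Finset.sum_coe_sort S fun e => (p e : ℂ), ← Complex.ofReal_sum]
          congr 1
          simp only [Fintype.card_fun, Fintype.card_fin, Nat.cast_pow, Nat.cast_ofNat]
          rw [mul_right_comm, ← mul_pow]
          norm_num
      _ ≤ ∑ z : K ⊕ L → Fin 2, ∑ e : S, (aliceKraus T B z ⊗ₖ bobKraus T B z e) * τ *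
            (aliceKraus T B z ⊗ₖ bobKraus T B z e)ᴴ := by
          apply Finset.sum_le_sum
          intro z _
          apply Finset.sum_le_sum
          intro e _
          rw [← alice_bob_conj T B z e, ← Matrix.smul_mul, ← Matrix.mul_smul]
          exact conj_mono (hp e e.2) _
      _ ≤ Λ τ := by
          rw [hΛdef, krausMap_apply, Fintype.sum_prod_type]
          apply Finset.sum_le_sum
          intro z _
          rw [Fintype.sum_sum_type]
          exact le_add_of_nonneg_right (Finset.sum_nonneg fun g _ => conj_nonneg hτ.1 _)
  refine ⟨Λ, hΛ, ?_⟩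
  have hσ : (tpow K sigmaPlus).PosSemidef :=
    (IsState.tpow ⟨bellProj_posSemidef 0 0, trace_bellProj 0 0⟩ K).1
  have h1 := traceNorm_sub_le
    (hσ.smul (a := ((1 - ∑ e ∈ S, p e : ℝ) : ℂ)) (by exact_mod_cast sub_nonneg.2 hp1))
    (Matrix.le_iff.1 hle)
  have h2 : (((1 - ∑ e ∈ S, p e : ℝ) : ℂ)) • tpow K sigmaPlus -
      (Λ τ - ((∑ e ∈ S, p e : ℝ) : ℂ) • tpow K sigmaPlus) = tpow K sigmaPlus - Λ τ := by
    rw [Complex.ofReal_sub, sub_smul, Complex.ofReal_one, one_smul]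
    abel
  rw [h2] at h1
  refine h1.trans (le_of_eq ?_)
  rw [Matrix.trace_sub, Matrix.trace_smul, Matrix.trace_smul, trace_tpow_sigmaPlus,
    hΛ.trace_apply, hτ.2, smul_eq_mul, smul_eq_mul, mul_one, mul_one, Complex.ofReal_re,
    Complex.sub_re, Complex.ofReal_re, Complex.one_re]
  ring

/-- Entanglement distillation with a random code: if `S` is a set of errors, then one-way LOCC
distills `|K|` ebits out of `|K| + |L|` Bell pairs up to the probability of an error outside `S`
and the ratio `|S| / 2 ^ |L|`. -/
theorem exists_isLOCC_of_bellDiagonal (p : Fin 2 × Fin 2 → ℝ) (hp : ∀ e, 0 ≤ p e)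
    (hp1 : ∑ e, p e = 1) (S : Finset (K ⊕ L → Fin 2 × Fin 2)) :
    ∃ Λ : Matrix ((K ⊕ L → Fin 2) × (K ⊕ L → Fin 2)) ((K ⊕ L → Fin 2) × (K ⊕ L → Fin 2)) ℂ →ₗ[ℂ]
        Matrix ((K → Fin 2) × (K → Fin 2)) ((K → Fin 2) × (K → Fin 2)) ℂ,
      IsLOCC Λ ∧ traceNorm (tpow K sigmaPlus -
        Λ (tpow (K ⊕ L) (∑ e : Fin 2 × Fin 2, (p e : ℂ) • bellProj e.1 e.2))) ≤
          2 * (∑ e ∈ Sᶜ, ∏ j, p (e j) + 2 * S.card / 2 ^ Fintype.card L) := by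
  classical
  set τ₁ := ∑ e : Fin 2 × Fin 2, (p e : ℂ) • bellProj e.1 e.2 with hτ₁
  have hst : IsState τ₁ := by
    refine ⟨Matrix.posSemidef_sum _ fun e _ => (bellProj_posSemidef e.1 e.2).smul
      (by exact_mod_cast hp e), ?_⟩
    simp only [hτ₁, Matrix.trace_sum, Matrix.trace_smul, trace_bellProj, smul_eq_mul, mul_one]
    rw [← Complex.ofReal_sum, hp1, Complex.ofReal_one]
  set q : (K ⊕ L → Fin 2 × Fin 2) → ℝ := fun e => ∏ j, p (e j) with hq
  have hq0 : ∀ e, 0 ≤ q e := fun e => Finset.prod_nonneg fun j _ => hp _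
  have hq1 : ∑ e, q e = 1 := by
    have := Finset.prod_univ_sum (fun _ : K ⊕ L => Finset.univ) (fun _ => p)
    rw [Fintype.piFinset_univ] at this
    rw [hq, ← this]
    simp [hp1]
  obtain ⟨⟨T, B⟩, hθ⟩ := exists_sum_bad_le
    (Θ := Matrix K L (Fin 2) × Matrix (K ⊕ L) (K ⊕ L) (Fin 2)) S q hq0 hq1
    (fun θ e f => dualHash θ.1 (Prod.fst ∘ e + Prod.fst ∘ f +
      (θ.2 + θ.2ᵀ) *ᵥ (Prod.snd ∘ e + Prod.snd ∘ f)) = 0) (2 ^ Fintype.card L) (by positivity)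
    (fun e f hef => card_not_detects_le (by
      by_contra! h
      rw [add_eq_zero_iff_binary, add_eq_zero_iff_binary] at h
      exact hef (funext fun j => Prod.ext (congrFun h.1 j).symm (congrFun h.2 j).symm)))
  simp only at hθ
  set S' := S.filter fun e => ¬ ∃ f ∈ S, e ≠ f ∧ dualHash T (Prod.fst ∘ e + Prod.fst ∘ f +
      (B + Bᵀ) *ᵥ (Prod.snd ∘ e + Prod.snd ∘ f)) = 0 with hS'
  obtain ⟨Λ, hΛ, hle⟩ := exists_isLOCC_traceNorm_le T B S' (fun e he f hf hef => by
      by_contra h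
      exact (Finset.mem_filter.1 he).2 ⟨f, (Finset.mem_filter.1 hf).1, hef,
        dualHash_eq_zero_of_not_detects h⟩) q (hst.tpow (K ⊕ L)) (fun e _ => by
      rw [tpow_bellDiagonal]
      exact Finset.single_le_sum (f := fun e : K ⊕ L → Fin 2 × Fin 2 => (q e : ℂ) •
          vecMulVec (bellString e) (star (bellString e)))
        (fun e _ => ((posSemidef_vecMulVec_self_star _).smul
          (by exact_mod_cast hq0 e)).nonneg) (Finset.mem_univ e))
      ((Finset.sum_le_univ_sum_of_nonneg hq0).trans hq1.le)
  refine ⟨Λ, hΛ, hle.trans ?_⟩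
  have h1 := Finset.sum_filter_add_sum_filter_not S (fun e => ∃ f ∈ S, e ≠ f ∧
    dualHash T (Prod.fst ∘ e + Prod.fst ∘ f +
      (B + Bᵀ) *ᵥ (Prod.snd ∘ e + Prod.snd ∘ f)) = 0) q
  rw [← hS'] at h1
  have h2 := Finset.sum_add_sum_compl S q
  push_cast at hθ
  linarith

end Protocol

end RandomCodes

/-! ### Typical sequences and the rate -/

open Filter Topology

section Typical

variable {X : Type} [Fintype X] [DecidableEq X]

/-- The tilted sum `∑ p ^ (1 - s) e ^ (-β s)` has the value `1` and a negative derivative at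
`s = 0` if `β` exceeds the entropy of `p` in nats. The power of `p` is written with the exponential
and the logarithm, so that the terms with `p x = 0` vanish for all `s`. -/
theorem exists_tilted_sum_lt_one {p : X → ℝ} (hp1 : ∑ x, p x = 1) {β : ℝ}
    (hβ : ∑ x, Real.negMulLog (p x) < β) :
    ∃ s > 0, ∑ x, p x * Real.exp (-s * (Real.log (p x) + β)) < 1 := by
  have hd : HasDerivAt (fun s : ℝ => ∑ x, p x * Real.exp (-s * (Real.log (p x) + β)))
      (∑ x, p x * (Real.exp (-0 * (Real.log (p x) + β)) * (-1 * (Real.log (p x) + β)))) 0 :=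
    HasDerivAt.fun_sum fun x _ =>
      (((hasDerivAt_neg (0 : ℝ)).mul_const (Real.log (p x) + β)).exp).const_mul (p x)
  have hval : ∑ x, p x * (Real.exp (-0 * (Real.log (p x) + β)) * (-1 * (Real.log (p x) + β))) =
      ∑ x, Real.negMulLog (p x) - β := by
    have : ∀ x, p x * (Real.exp (-0 * (Real.log (p x) + β)) * (-1 * (Real.log (p x) + β))) =
        Real.negMulLog (p x) - p x * β := fun x => by
      rw [Real.negMulLog, neg_zero, zero_mul, Real.exp_zero]
      ring
    simp only [this, Finset.sum_sub_distrib, ← Finset.sum_mul, hp1, one_mul]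
  rw [hval] at hd
  have h1 := hd.tendsto_slope_zero_right.eventually_lt_const (sub_neg.2 hβ)
  obtain ⟨s, hs, hs0⟩ := (h1.and self_mem_nhdsWithin).exists
  have hs0' : (0 : ℝ) < s := hs0
  refine ⟨s, hs0', ?_⟩
  simp only [zero_add, smul_eq_mul, neg_zero, zero_mul, Real.exp_zero, mul_one, hp1] at hs
  rw [inv_mul_lt_iff₀ hs0', mul_zero] at hs
  linarith

/-- The sequences of probability at least `exp (-n β)`, where `n = |J|`. -/
def typicalSet (J : Type) [Fintype J] [DecidableEq J] (p : X → ℝ) (β : ℝ) : Finset (J → X) :=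
  Finset.univ.filter fun e => Real.exp (-(Fintype.card J * β)) ≤ ∏ j, p (e j)

theorem sum_prod_apply_eq_pow (J : Type) [Fintype J] [DecidableEq J] (f : X → ℝ) :
    ∑ e : J → X, ∏ j, f (e j) = (∑ x, f x) ^ Fintype.card J := by
  have := Finset.prod_univ_sum (fun _ : J => (Finset.univ : Finset X)) (fun _ => f)
  rw [Fintype.piFinset_univ] at this
  rw [← this, Finset.prod_const, Finset.card_univ]

theorem card_typicalSet_le (J : Type) [Fintype J] [DecidableEq J] {p : X → ℝ} (hp : ∀ x, 0 ≤ p x)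
    (hp1 : ∑ x, p x = 1) (β : ℝ) :
    ((typicalSet J p β).card : ℝ) ≤ Real.exp (Fintype.card J * β) := by
  have h1 : (typicalSet J p β).card * Real.exp (-(Fintype.card J * β)) ≤ 1 := by
    calc _ = ∑ e ∈ typicalSet J p β, Real.exp (-(Fintype.card J * β)) := by
          rw [Finset.sum_const, nsmul_eq_mul]
      _ ≤ ∑ e ∈ typicalSet J p β, ∏ j, p (e j) :=
          Finset.sum_le_sum fun e he => (Finset.mem_filter.1 he).2
      _ ≤ ∑ e : J → X, ∏ j, p (e j) :=
          Finset.sum_le_univ_sum_of_nonneg fun e => Finset.prod_nonneg fun j _ => hp _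
      _ = 1 := by rw [sum_prod_apply_eq_pow, hp1, one_pow]
  rwa [Real.exp_neg, ← div_eq_mul_inv, div_le_one (Real.exp_pos _)] at h1

/-- The Chernoff bound for the probability of the atypical sequences. -/
theorem sum_compl_typicalSet_le (J : Type) [Fintype J] [DecidableEq J] {p : X → ℝ}
    (hp : ∀ x, 0 ≤ p x) {β s : ℝ} (hs : 0 < s) :
    ∑ e ∈ (typicalSet J p β)ᶜ, ∏ j, p (e j) ≤
      (∑ x, p x * Real.exp (-s * (Real.log (p x) + β))) ^ Fintype.card J := by
  have hnn : ∀ e : J → X, 0 ≤ ∏ j, p (e j) * Real.exp (-s * (Real.log (p (e j)) + β)) := fun e =>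
    Finset.prod_nonneg fun j _ => mul_nonneg (hp _) (Real.exp_pos _).le
  rw [← sum_prod_apply_eq_pow]
  refine le_trans (Finset.sum_le_sum fun e he => ?_) (Finset.sum_le_univ_sum_of_nonneg hnn)
  by_cases h0 : ∃ j, p (e j) = 0
  · obtain ⟨j, hj⟩ := h0
    rw [Finset.prod_eq_zero (Finset.mem_univ j) hj]
    exact hnn e
  · push Not at h0
    have hpos : 0 < ∏ j, p (e j) := Finset.prod_pos fun j _ => (hp _).lt_of_ne' (h0 j)
    have hlt : ∏ j, p (e j) < Real.exp (-(Fintype.card J * β)) := by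
      simpa [typicalSet] using he
    rw [← Real.log_lt_iff_lt_exp hpos, Real.log_prod fun j _ => h0 j] at hlt
    rw [Finset.prod_mul_distrib, ← Real.exp_sum]
    refine le_mul_of_one_le_right hpos.le (Real.one_le_exp ?_)
    rw [← Finset.mul_sum, Finset.sum_add_distrib, Finset.sum_const, Finset.card_univ,
      nsmul_eq_mul]
    nlinarith

end Typical

/-- Bell-diagonal states of entropy `h < 1` are distilled at the rate `(1 - h) / 2`. -/
theorem exists_isLOCC_bellDiagonal_rate {p : Fin 2 × Fin 2 → ℝ} (hp : ∀ e, 0 ≤ p e)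
    (hp1 : ∑ e, p e = 1) {h : ℝ} (hh : h = (∑ e, Real.negMulLog (p e)) / Real.log 2)
    (h1 : h < 1) {ε : ℝ} (hε : 0 < ε) :
    ∃ k m : ℕ, 1 ≤ k + m ∧ (1 - h) / 2 * (k + m : ℕ) ≤ k ∧
      ∃ Λ : Matrix ((Fin k ⊕ Fin m → Fin 2) × (Fin k ⊕ Fin m → Fin 2))
          ((Fin k ⊕ Fin m → Fin 2) × (Fin k ⊕ Fin m → Fin 2)) ℂ →ₗ[ℂ]
          Matrix ((Fin k → Fin 2) × (Fin k → Fin 2)) ((Fin k → Fin 2) × (Fin k → Fin 2)) ℂ,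
        IsLOCC Λ ∧ traceNorm (tpow (Fin k) sigmaPlus -
          Λ (tpow (Fin k ⊕ Fin m) (∑ e : Fin 2 × Fin 2, (p e : ℂ) • bellProj e.1 e.2))) < ε := by
  have hl : 0 < Real.log 2 := Real.log_pos (by norm_num)
  have hple : ∀ e, p e ≤ 1 := fun e => hp1 ▸
    Finset.single_le_sum (fun i _ => hp i) (Finset.mem_univ e)
  have hh0 : 0 ≤ h := by
    rw [hh]
    exact div_nonneg (Finset.sum_nonneg fun e _ => Real.negMulLog_nonneg (hp e) (hple e)) hl.le
  -- `(1 + 3 h) / 4` lies between the entropy `h` and the fraction `(1 + h) / 2` of sacrificed pairs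
  set α := (1 + 3 * h) / 4 with hα
  obtain ⟨s, hs, hr1⟩ := exists_tilted_sum_lt_one hp1 (β := α * Real.log 2) (by
    rw [← div_lt_iff₀ hl, ← hh, hα]
    linarith)
  set r := ∑ x, p x * Real.exp (-s * (Real.log (p x) + α * Real.log 2)) with hr
  have hr0 : 0 ≤ r := Finset.sum_nonneg fun x _ => mul_nonneg (hp x) (Real.exp_pos _).le
  set t := Real.exp (-((1 - h) / 4 * Real.log 2)) with ht
  have ht1 : t < 1 := by
    rw [ht, Real.exp_lt_one_iff]
    have : 0 < (1 - h) / 4 * Real.log 2 := mul_pos (by linarith) hl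
    linarith
  have hlim : Tendsto (fun n : ℕ => 2 * (r ^ n + 4 * t ^ n)) atTop (𝓝 (2 * (0 + 4 * 0))) :=
    ((tendsto_pow_atTop_nhds_zero_of_lt_one hr0 hr1).add
      ((tendsto_pow_atTop_nhds_zero_of_lt_one (Real.exp_pos _).le ht1).const_mul 4)).const_mul 2
  obtain ⟨n, hn, hn1⟩ := ((hlim.eventually_lt_const (by simpa using hε)).and
    (eventually_ge_atTop 1)).exists
  set k := ⌈(1 - h) / 2 * n⌉₊ with hk
  have hn0 : (1 : ℝ) ≤ n := by exact_mod_cast hn1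
  have hkn : k ≤ n := Nat.ceil_le.2 (by nlinarith)
  have hnk : k + (n - k) = n := by omega
  have hklt : (k : ℝ) < (1 - h) / 2 * n + 1 :=
    Nat.ceil_lt_add_one (mul_nonneg (by linarith) (by linarith))
  obtain ⟨Λ, hΛ, hle⟩ := exists_isLOCC_of_bellDiagonal (K := Fin k) (L := Fin (n - k)) p hp hp1
    (typicalSet _ p (α * Real.log 2))
  refine ⟨k, n - k, by omega, by rw [hnk]; exact Nat.le_ceil _, Λ, hΛ, hle.trans_lt
    (lt_of_le_of_lt ?_ hn)⟩
  have hcard : Fintype.card (Fin k ⊕ Fin (n - k)) = n := by simp [hnk]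
  have e1 := sum_compl_typicalSet_le (Fin k ⊕ Fin (n - k)) hp (β := α * Real.log 2) hs
  have e2 := card_typicalSet_le (Fin k ⊕ Fin (n - k)) hp hp1 (α * Real.log 2)
  rw [hcard] at e1 e2
  have e3 : Real.exp (n * (α * Real.log 2)) / 2 ^ (n - k) ≤ 2 * t ^ n := by
    have h2 : (2 : ℝ) = Real.exp (Real.log 2) := (Real.exp_log (by norm_num)).symm
    have h2m : (2 : ℝ) ^ (n - k) = Real.exp ((n - k : ℕ) * Real.log 2) := by
      rw [Real.exp_nat_mul, ← h2]
    rw [h2m, ← Real.exp_sub, ht, ← Real.exp_nat_mul]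
    refine le_of_le_of_eq (Real.exp_le_exp.2 (?_ : _ ≤ Real.log 2 +
      n * -((1 - h) / 4 * Real.log 2))) (by rw [Real.exp_add, ← h2])
    rw [Nat.cast_sub hkn, hα]
    have : (n : ℝ) * ((1 + 3 * h) / 4) - (n - k) ≤ 1 - n * ((1 - h) / 4) := by linarith
    nlinarith
  have e4 : 2 * ((typicalSet (Fin k ⊕ Fin (n - k)) p (α * Real.log 2)).card : ℝ) / 2 ^ (n - k) ≤
      4 * t ^ n := by
    rw [mul_div_assoc]
    have := (div_le_div_of_nonneg_right e2 (by positivity : (0 : ℝ) ≤ 2 ^ (n - k))).trans e3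
    linarith
  rw [Fintype.card_fin]
  linarith

section Rate

variable {A B : Type} [Fintype A] [DecidableEq A] [Fintype B] [DecidableEq B]

/-- The rate `(1 - h) / 2` for the Bell-diagonal state is divided by the number `N` of copies of `ρ`
that are spent on each of its copies. -/
theorem distillableAtRate_of_bellDiagonal (ρ : Matrix (A × B) (A × B) ℂ) {N : ℕ} (hN : 1 ≤ N)
    {τ : Matrix (Fin 2 × Fin 2) (Fin 2 × Fin 2) ℂ} (hτ : Converts (tensorPow ρ N) τ)
    (hb : IsBellDiagonal τ) (h1 : entropy τ < 1) :
    DistillableAtRate ρ ((1 - entropy τ) / (2 * N)) := by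
  obtain ⟨p, hp, hp1, hpτ⟩ := hb.exists_prod
  have hent : entropy τ = (∑ e, Real.negMulLog (p e)) / Real.log 2 := by
    rw [hpτ, entropy_bellDiagonal]
  refine ⟨?_, fun b hb => ?_⟩
  · rintro _ ⟨_, _, _, _, _, _, rfl⟩
    exact traceNorm_nonneg _
  by_contra! hb0
  obtain ⟨k, m, hn, hk, Λ, hΛ, hlt⟩ := exists_isLOCC_bellDiagonal_rate hp hp1 hent h1 hb0
  rw [← hpτ] at hlt
  -- group `N (k + m)` copies of `ρ` into `k + m` blocks and turn each block into `τ`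
  have e : Fin (N * (k + m)) ≃ (Fin k ⊕ Fin m) × Fin N :=
    Fintype.equivOfCardEq (by simp [mul_comm])
  have hconv : Converts (tensorPow ρ (N * (k + m))) (tpow (Fin k ⊕ Fin m) τ) :=
    ((converts_tpow_congr e ρ).trans (converts_tpow_prod ρ)).trans (hτ.tpow (Fin k ⊕ Fin m))
  obtain ⟨Θ, hΘ, hΘe⟩ := hconv.trans ⟨Λ, hΛ, rfl⟩
  have hN0 : (N : ℝ) ≠ 0 := by
    have : (1 : ℝ) ≤ N := by exact_mod_cast hN
    linarith
  have := hb ⟨N * (k + m), k, Θ, Nat.mul_pos hN hn, by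
    calc (1 - entropy τ) / (2 * N) * ((N * (k + m) : ℕ) : ℝ) =
          (1 - entropy τ) / 2 * (k + m : ℕ) := by
          push_cast
          field_simp
      _ ≤ k := hk, hΘ, rfl⟩
  rw [hΘe] at this
  exact absurd hlt this.not_gt

end Rate

end Distill

end

theorem mainTheorem1 {A B : Type} [Fintype A] [DecidableEq A] [Fintype B] [DecidableEq B]
    (ρ : Matrix (A × B) (A × B) ℂ) (hρ : Distill.IsState ρ)
    (hsingle : Distill.SingleDistillable ρ) :
    -- finitely many copies suffice for a Bell-diagonal state of arbitrarily low entropy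
    (∀ h : ℝ, 0 < h → ∃ (N : ℕ)
      (Λ : Matrix ((Fin N → A) × (Fin N → B)) ((Fin N → A) × (Fin N → B)) ℂ →ₗ[ℂ]
        Matrix (Fin 2 × Fin 2) (Fin 2 × Fin 2) ℂ),
      1 ≤ N ∧ Distill.IsLOCC Λ ∧ Distill.IsBellDiagonal (Λ (Distill.tensorPow ρ N)) ∧
        Distill.entropy (Λ (Distill.tensorPow ρ N)) < h) ∧
    -- any such Bell-diagonal state of entropy `h < 1` from `N` copies gives rate `(1 - h) / (2 N)`
    (∀ (N : ℕ)
      (Λ : Matrix ((Fin N → A) × (Fin N → B)) ((Fin N → A) × (Fin N → B)) ℂ →ₗ[ℂ]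
        Matrix (Fin 2 × Fin 2) (Fin 2 × Fin 2) ℂ),
      1 ≤ N → Distill.IsLOCC Λ → Distill.IsBellDiagonal (Λ (Distill.tensorPow ρ N)) →
        Distill.entropy (Λ (Distill.tensorPow ρ N)) < 1 →
        Distill.DistillableAtRate ρ
          ((1 - Distill.entropy (Λ (Distill.tensorPow ρ N))) / (2 * N))) ∧
    Distill.RateDistillable ρ := by
  have hrate : ∀ (N : ℕ)
      (Λ : Matrix ((Fin N → A) × (Fin N → B)) ((Fin N → A) × (Fin N → B)) ℂ →ₗ[ℂ]
        Matrix (Fin 2 × Fin 2) (Fin 2 × Fin 2) ℂ),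
      1 ≤ N → Distill.IsLOCC Λ → Distill.IsBellDiagonal (Λ (Distill.tensorPow ρ N)) →
        Distill.entropy (Λ (Distill.tensorPow ρ N)) < 1 →
        Distill.DistillableAtRate ρ
          ((1 - Distill.entropy (Λ (Distill.tensorPow ρ N))) / (2 * N)) :=
    fun N Λ hN hΛ hb h1 =>
      Distill.distillableAtRate_of_bellDiagonal ρ hN ⟨Λ, hΛ, rfl⟩ hb h1
  refine ⟨fun h hh => hsingle.exists_bellDiagonal hρ hh, hrate, ?_⟩
  obtain ⟨N, Λ, hN, hΛ, hb, h1⟩ := hsingle.exists_bellDiagonal hρ one_pos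
  exact ⟨_, div_pos (sub_pos.2 h1) (by positivity), hrate N Λ hN hΛ hb h1⟩
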